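/- All objects are smooth. For a distribution $\Delta$ on a manifold $M$ let $\Delta_1=\Delta$, $\Delta_{i+1}=\Delta_i+[\Delta,\Delta_i]$ be its weak derived flag; its growth vector is $(\dim\Delta_1,\dim\Delta_2/\Delta_1,\dim\Delta_3/\Delta_2,\dots)$. A finite-dimensional graded real Lie algebra $\mathfrak m=\bigoplus_{i\ge1}\mathfrak g_{-i}$ is a fundamental graded nilpotent Lie algebra if $\mathfrak g_{-1}$ generates it; its standard model is the simply connected Lie group of $\mathfrak m$ with the left-invariant distribution defined by $\mathfrak g_{-1}$. The distribution $\Delta$ is flat if, for some fundamental graded nilpotent $\mathfrak m$, it is near every point locally diffeomorphic to the standard model of $\mathfrak m$. An integrable extension of $(M,\Delta)$ is a surjective submersion $\pi:\tilde M\to M$ with a distribution $\tilde\Delta$ on $\tilde M$ such that $d_x\pi:\tilde\Delta_x\to\Delta_{\pi(x)}$ is an isomorphism for all $x\in\tilde M$ and $\tilde\Delta_2\cap\ker d\pi=0$. It is non-trivial if $\tilde\Delta$ is completely non-holonomic ($\tilde\Delta_k=T\tilde M$ for some $k$), and its fibres have pure grading $-k$ if $\ker d\pi\subset\tilde\Delta_k$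 and $\ker d\pi\cap\tilde\Delta_{k-1}=0$. The Monge equation $y^{(m)}=F(x,y,\dots,y^{(m-1)},z,\dots,z^{(n)})$ defines the rank 2 distribution $\langle \partial_x+\sum_{i<m-1}y_{i+1}\partial_{y_i}+F\,\partial_{y_{m-1}}+\sum_{j<n}z_{j+1}\partial_{z_j},\ \partial_{z_n}\rangle$ on an open subset of $\mathbb R^{m+n+2}(x,y_0,\dots,y_{m-1},z_0,\dots,z_n)$. The underdetermined ODE system $u_i'=G_i(x,u_1,\dots,u_N,w)$, $1\le i\le N$, defines the rank 2 distribution $\langle\partial_x+\sum_iG_i\partial_{u_i},\ \partial_w\rangle$ on an open subset of $\mathbb R^{N+2}(x,u_1,\dots,u_N,w)$. **Theorem.** (a) Let $\Delta$ be a flat rank 2 distribution with growth vector $(2,1,2,\dots)$ on a manifold $M$. Then there are distributions $D_0,\dots,D_r$ on $\mathbb R^{d_0},\dots,\mathbb R^{d_r}$, $5=d_0<d_1<\dots<d_r$, such that $D_0$ is the distribution of the Hilbert–Cartan equation $y'=(z'')^2$; each $D_{i+1}$ has rank 2, is flat, and is a non-trivial integrable extension of $D_i$ with fibres of pure grading $-k_i$,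 $k_i>3$; and $\Delta$ is near every point of $M$ locally diffeomorphic to $D_r$. In particular the conclusion of (a) holds in the following two cases. (b) $\Delta$ is the distribution of a single Monge equation as above with $0<m\le n$, $(m,n)\ne(1,1)$, that is non-degenerate ($F_{z^{(n)}z^{(n)}}\ne0$ everywhere on its domain), and $\Delta$ is flat. (c) $\Delta$ is the distribution of an underdetermined ODE system as above, and $\Delta$ is flat with growth vector $(2,1,2,\dots)$. -/

import Mathlib

open scoped Manifold ContDiff Topology

noncomputable section

namespace Monge

/-! ### Distributions on manifolds, their weak derived flags, integrable extensions -/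

section Manifolds

variable {E : Type*} [NormedAddCommGroup E] [NormedSpace ℝ E]
  {M : Type*} [TopologicalSpace M] [ChartedSpace E M] [IsManifold 𝓘(ℝ, E) ∞ M]
  {E' : Type*} [NormedAddCommGroup E'] [NormedSpace ℝ E']
  {M' : Type*} [TopologicalSpace M'] [ChartedSpace E' M'] [IsManifold 𝓘(ℝ, E') ∞ M']

/-- The vector field `X` is smooth on the set `U`. -/
def SmoothOn (X : ∀ y : M, TangentSpace 𝓘(ℝ, E) y) (U : Set M) : Prop :=
  ContMDiffOn 𝓘(ℝ, E) (𝓘(ℝ, E)).tangent ∞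
    (fun y => (⟨y, X y⟩ : TangentBundle 𝓘(ℝ, E) M)) U

/-- `Δ` is a smooth distribution of rank `r`: a field of tangent subspaces which is locally spanned
by `r` smooth, pointwise linearly independent vector fields. -/
def IsDistribution (Δ : ∀ x : M, Submodule ℝ (TangentSpace 𝓘(ℝ, E) x)) (r : ℕ) : Prop :=
  ∀ p : M, ∃ U : Set M, IsOpen U ∧ p ∈ U ∧
    ∃ X : Fin r → ∀ y : M, TangentSpace 𝓘(ℝ, E) y,
      (∀ j, SmoothOn (X j) U) ∧
      ∀ y ∈ U, LinearIndependent ℝ (fun j => X j y) ∧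
        Δ y = Submodule.span ℝ (Set.range fun j => X j y)

/-- `X` restricts to a smooth section of `Δ` over some open neighbourhood of `x`. -/
def IsLocalSection (Δ : ∀ x : M, Submodule ℝ (TangentSpace 𝓘(ℝ, E) x)) (x : M)
    (X : ∀ y : M, TangentSpace 𝓘(ℝ, E) y) : Prop :=
  ∃ U : Set M, IsOpen U ∧ x ∈ U ∧ SmoothOn X U ∧ ∀ y ∈ U, X y ∈ Δ y

/-- The weak derived flag: `Δ₁ = Δ`, and `Δ_{i+1}` is spanned by `Δ_i` and by the brackets
`[X, Y]` of local sections `X` of `Δ` and `Y` of `Δ_i` (and `Δ₀ = 0`). -/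
def weakFlag (Δ : ∀ x : M, Submodule ℝ (TangentSpace 𝓘(ℝ, E) x)) :
    ℕ → ∀ x : M, Submodule ℝ (TangentSpace 𝓘(ℝ, E) x)
  | 0 => fun _ => ⊥
  | 1 => Δ
  | i + 2 => fun x => weakFlag Δ (i + 1) x ⊔ Submodule.span ℝ
      {v | ∃ X Y : ∀ y : M, TangentSpace 𝓘(ℝ, E) y,
        IsLocalSection Δ x X ∧ IsLocalSection (weakFlag Δ (i + 1)) x Y ∧
        v = VectorField.mlieBracket 𝓘(ℝ, E) X Y x}

/-- The growth vector `(dim Δ₁, dim Δ₂/Δ₁, dim Δ₃/Δ₂, …)` starts with `(2, 1, 2, …)` at every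
point of `W`. -/
def HasGrowthTwoOneTwoOn (Δ : ∀ x : M, Submodule ℝ (TangentSpace 𝓘(ℝ, E) x)) (W : Set M) : Prop :=
  ∀ x ∈ W, Module.finrank ℝ (weakFlag Δ 1 x) = 2 ∧
    Module.finrank ℝ (weakFlag Δ 2 x) = 2 + 1 ∧
    Module.finrank ℝ (weakFlag Δ 3 x) = 2 + 1 + 2

/-- `Δ` is completely non-holonomic: some member of the weak derived flag is the whole tangent
bundle. -/
def CompletelyNonholonomic (Δ : ∀ x : M, Submodule ℝ (TangentSpace 𝓘(ℝ, E) x)) : Prop :=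
  ∃ k : ℕ, ∀ x, weakFlag Δ k x = ⊤

/-- A smooth diffeomorphism from an open neighbourhood of `p` onto an open subset of `M'`
carries `Δ` to `Δ'`. -/
def LocallyEquivalentAt (Δ : ∀ x : M, Submodule ℝ (TangentSpace 𝓘(ℝ, E) x)) (p : M)
    (Δ' : ∀ x : M', Submodule ℝ (TangentSpace 𝓘(ℝ, E') x)) : Prop :=
  ∃ φ : OpenPartialHomeomorph M M', p ∈ φ.source ∧
    ContMDiffOn 𝓘(ℝ, E) 𝓘(ℝ, E') ∞ φ φ.source ∧
    ContMDiffOn 𝓘(ℝ, E') 𝓘(ℝ, E) ∞ φ.symm φ.target ∧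
    ∀ x ∈ φ.source,
      Δ' (φ x) = (Δ x).map (mfderiv 𝓘(ℝ, E) 𝓘(ℝ, E') φ x).toLinearMap

/-- `π : (M', Δ') → (M, Δ)` is an integrable extension (covering): a surjective submersion which
maps `Δ'` isomorphically onto `Δ` pointwise, with `Δ'₂ ∩ Ker dπ = 0`. -/
structure IsIntegrableExtension (π : M' → M)
    (Δ' : ∀ x : M', Submodule ℝ (TangentSpace 𝓘(ℝ, E') x))
    (Δ : ∀ x : M, Submodule ℝ (TangentSpace 𝓘(ℝ, E) x)) : Prop where
  smooth : ContMDiff 𝓘(ℝ, E') 𝓘(ℝ, E) ∞ π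
  surjective : Function.Surjective π
  submersion : ∀ x, Function.Surjective (mfderiv 𝓘(ℝ, E') 𝓘(ℝ, E) π x)
  bijOn : ∀ x, Set.BijOn (mfderiv 𝓘(ℝ, E') 𝓘(ℝ, E) π x) (Δ' x) (Δ (π x))
  horizontal : ∀ x,
    weakFlag Δ' 2 x ⊓ (mfderiv 𝓘(ℝ, E') 𝓘(ℝ, E) π x).toLinearMap.ker = ⊥

/-- The tangents to the fibres of `π` have pure grading `-k` with respect to the weak derived flag
of `Δ'`: they lie in `Δ'_k` and meet `Δ'_{k-1}` trivially. -/
def HasPureGrading (π : M' → M) (Δ' : ∀ x : M', Submodule ℝ (TangentSpace 𝓘(ℝ, E') x))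
    (k : ℕ) : Prop :=
  ∀ x, (mfderiv 𝓘(ℝ, E') 𝓘(ℝ, E) π x).toLinearMap.ker ≤ weakFlag Δ' k x ∧
    weakFlag Δ' (k - 1) x ⊓ (mfderiv 𝓘(ℝ, E') 𝓘(ℝ, E) π x).toLinearMap.ker = ⊥

end Manifolds

/-! ### Flat distributions -/

section Flat

variable {L : Type*} [LieRing L] [LieAlgebra ℝ L]

/-- `L = ⊕_{i ≥ 1} g i` is a fundamental graded nilpotent Lie algebra; `g i` is the
component of degree `-i`, and fundamental means that the component of degree `-1` generates.
(In finite dimension such an `L` is automatically nilpotent.) -/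
structure IsFundamentalGNLA (g : ℕ → Submodule ℝ L) : Prop where
  finite : FiniteDimensional ℝ L
  zero : g 0 = ⊥
  internal : DirectSum.IsInternal g
  lie_mem : ∀ i j x y, x ∈ g i → y ∈ g j → ⁅x, y⁆ ∈ g (i + j)
  generates : LieSubalgebra.lieSpan ℝ L (g 1 : Set L) = ⊤

/-- The left-invariant Maurer-Cartan form of the simply connected Lie group of a finite-dimensional
nilpotent Lie algebra `L`, in exponential coordinates `exp : L → G` (a global diffeomorphism):
`θ_x = (1 - exp (-ad x)) / ad x = ∑ k, (-1)^k / (k+1)! (ad x)^k`. The sum is finite, since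
`(ad x)^k = 0` for `k ≥ dim L`. -/
def maurerCartan (x : L) : L →ₗ[ℝ] L :=
  ∑ k ∈ Finset.range (Module.finrank ℝ L),
    ((-1 : ℝ) ^ k / (Nat.factorial (k + 1) : ℝ)) • (LieAlgebra.ad ℝ L x) ^ k

variable {E : Type*} [NormedAddCommGroup E] [NormedSpace ℝ E]

/-- The standard model of a graded nilpotent Lie algebra: the left-invariant distribution defined
by the component of degree `-1` on the simply connected Lie group of `L`. The group is written
in exponential coordinates, and `e` chooses linear coordinates on `L`. -/
def standardDistribution (g : ℕ → Submodule ℝ L) (e : E ≃ₗ[ℝ] L) :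
    ∀ x : E, Submodule ℝ (TangentSpace 𝓘(ℝ, E) x) :=
  fun x => (g 1).comap (maurerCartan (e x) ∘ₗ e.toLinearMap)

/-- `Δ` is flat on `W`: near every point of `W` it is locally equivalent to the
standard model of one and the same fundamental graded nilpotent Lie algebra. -/
def IsFlatOn {M : Type*} [TopologicalSpace M] [ChartedSpace E M] [IsManifold 𝓘(ℝ, E) ∞ M]
    (Δ : ∀ x : M, Submodule ℝ (TangentSpace 𝓘(ℝ, E) x)) (W : Set M) : Prop :=
  ∃ (L : Type) (_ : LieRing L) (_ : LieAlgebra ℝ L) (g : ℕ → Submodule ℝ L) (e : E ≃ₗ[ℝ] L),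
    IsFundamentalGNLA g ∧ ∀ p ∈ W, LocallyEquivalentAt Δ p (standardDistribution g e)

end Flat

/-! ### Differential equations as rank 2 distributions -/

/-- The coordinate vector field `∂/∂w` in `ℝ^(N+2)` with coordinates `(x, u_1, …, u_N, w)`. -/
def lastVector (N : ℕ) : EuclideanSpace ℝ (Fin (N + 2)) :=
  EuclideanSpace.single (Fin.last (N + 1)) 1

/-- The total derivative `D_x = ∂/∂x + ∑ i, G_i ∂/∂u_i` of the system `u' = G(x, u, w)`. -/
def totalDerivative {N : ℕ} (G : EuclideanSpace ℝ (Fin (N + 2)) → Fin N → ℝ)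
    (p : EuclideanSpace ℝ (Fin (N + 2))) : EuclideanSpace ℝ (Fin (N + 2)) :=
  WithLp.toLp 2 (Fin.cons 1 (Fin.snoc (G p) 0) : Fin (N + 1 + 1) → ℝ)

/-- The rank 2 distribution `⟨D_x, ∂/∂w⟩` of the underdetermined system of ODEs
`u_i' = G_i(x, u_1, …, u_N, w)`, `1 ≤ i ≤ N`, in `ℝ^(N+2)` with coordinates
`(x, u_1, …, u_N, w)`. -/
def odeDistribution {N : ℕ} (G : EuclideanSpace ℝ (Fin (N + 2)) → Fin N → ℝ) :
    ∀ p : EuclideanSpace ℝ (Fin (N + 2)),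
      Submodule ℝ (TangentSpace 𝓘(ℝ, EuclideanSpace ℝ (Fin (N + 2))) p) :=
  fun p => Submodule.span ℝ
    ({totalDerivative G p, lastVector N} : Set (EuclideanSpace ℝ (Fin (N + 2))))

/-- The rank 2 distribution of the Monge equation
`y^(m) = F(x, y, …, y^(m-1), z, …, z^(n))` in `ℝ^(m+n+2)` with coordinates
`(x, y_0, …, y_(m-1), z_0, …, z_n)` (in this order): in `D_x` the coefficient of each jet
coordinate other than `z_n` is the next jet coordinate, except that the one of `y_(m-1)` is `F`. -/
def mongeDistribution (m n : ℕ) (F : EuclideanSpace ℝ (Fin (m + n + 2)) → ℝ) :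
    ∀ p : EuclideanSpace ℝ (Fin (m + n + 2)),
      Submodule ℝ (TangentSpace 𝓘(ℝ, EuclideanSpace ℝ (Fin (m + n + 2))) p) :=
  odeDistribution fun p i => if i.val + 1 = m then F p else p i.succ.succ

/-- The Hilbert-Cartan equation `y' = (z'')²` on `ℝ⁵` with coordinates `(x, y, z, z_1, z_2)`. -/
def hilbertCartan : ∀ p : EuclideanSpace ℝ (Fin 5),
    Submodule ℝ (TangentSpace 𝓘(ℝ, EuclideanSpace ℝ (Fin 5)) p) :=
  mongeDistribution 1 2 fun p => (p 4) ^ 2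

/-- The distributions on `ℝ^d` that are obtained from the Hilbert-Cartan equation by a finite
sequence of non-trivial integrable extensions with fibres of positive dimension and of pure grading
`-k`, `k > 3`, through flat rank 2 distributions. -/
inductive IsSuccessiveExtension : (d : ℕ) →
    (∀ x : EuclideanSpace ℝ (Fin d),
      Submodule ℝ (TangentSpace 𝓘(ℝ, EuclideanSpace ℝ (Fin d)) x)) → Prop
  | base : IsSuccessiveExtension 5 hilbertCartan
  | step {d d' : ℕ}
      {Δ : ∀ x : EuclideanSpace ℝ (Fin d),
        Submodule ℝ (TangentSpace 𝓘(ℝ, EuclideanSpace ℝ (Fin d)) x)}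
      {Δ' : ∀ x : EuclideanSpace ℝ (Fin d'),
        Submodule ℝ (TangentSpace 𝓘(ℝ, EuclideanSpace ℝ (Fin d')) x)}
      (π : EuclideanSpace ℝ (Fin d') → EuclideanSpace ℝ (Fin d)) (k : ℕ)
      (previous : IsSuccessiveExtension d Δ)
      (dim_lt : d < d')
      (rank_two : IsDistribution Δ' 2)
      (flat : IsFlatOn Δ' (Set.univ : Set (EuclideanSpace ℝ (Fin d'))))
      (extension : IsIntegrableExtension π Δ' Δ)
      (nontrivial : CompletelyNonholonomic Δ')
      (three_lt : 3 < k)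
      (pure : HasPureGrading (E := EuclideanSpace ℝ (Fin d)) π Δ' k) :
      IsSuccessiveExtension d' Δ'

/-- There is a distribution obtained from the Hilbert-Cartan equation by successive integrable
extensions to which `Δ` is locally equivalent near every point of `W`. -/
def ArisesFromHilbertCartanOn {E : Type*} [NormedAddCommGroup E] [NormedSpace ℝ E]
    {M : Type*} [TopologicalSpace M] [ChartedSpace E M] [IsManifold 𝓘(ℝ, E) ∞ M]
    (Δ : ∀ x : M, Submodule ℝ (TangentSpace 𝓘(ℝ, E) x)) (W : Set M) : Prop :=
  ∃ (d : ℕ) (Δ' : ∀ x : EuclideanSpace ℝ (Fin d),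
      Submodule ℝ (TangentSpace 𝓘(ℝ, EuclideanSpace ℝ (Fin d)) x)),
    IsSuccessiveExtension d Δ' ∧ ∀ p ∈ W, LocallyEquivalentAt Δ p Δ'

end Monge

end

/-!
In exponential coordinates the Maurer–Cartan form `θ` of the simply connected group of a graded
nilpotent Lie algebra `𝔪` is a coframe satisfying `dθ + [θ, θ] / 2 = 0`, so the weak derived flag of
the standard model consists of the left-invariant distributions defined by the sums
`𝔤₋₁ ⊕ ⋯ ⊕ 𝔤₋ₖ`, and the growth vector can be read off from `𝔪`.

If `𝔤₋μ` is the component of lowest degree, then it is a central ideal, and `𝔪 → 𝔪 / 𝔤₋μ` is, in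
exponential coordinates, an integrable extension of standard models whose fibres have pure
grading `-μ`. Dividing out the components of degree below `-3` one after the other leaves the
free nilpotent Lie algebra of step 3 on two generators, whose standard model is identified with
the Hilbert–Cartan equation by an explicit diffeomorphism.

For a Monge equation with `n ≥ 2`, the fields `X = D_x`, `V = ∂/∂z_n`, `[V, X]`, `[X, [V, X]]` and
`[V, [V, X]]` are triangular in the coordinates `(x, z_n, z_(n-1), z_(n-2), y_(m-1))`, with last
diagonal entry `∂²F/∂z_n²`.
-/

namespace Monge

section MaurerCartanEquation

variable {E : Type*} [NormedAddCommGroup E] [NormedSpace ℝ E]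

/-- The coefficients of the power series `(1 - exp (-z)) / z`. -/
noncomputable def maurerCartanCoeff (k : ℕ) : ℝ := (-1) ^ k / (k + 1).factorial

theorem maurerCartanCoeff_zero : maurerCartanCoeff 0 = 1 := by simp [maurerCartanCoeff]

theorem maurerCartanCoeff_succ (k : ℕ) :
    maurerCartanCoeff (k + 1) * (k + 2) = -maurerCartanCoeff k := by
  rw [maurerCartanCoeff, maurerCartanCoeff, Nat.factorial_succ (k + 1)]
  push_cast
  field_simp
  ring

/-- The left-invariant Maurer-Cartan form in exponential coordinates, for the Lie bracket `B`,
truncated at the power `N`; it is of interest when `(B x) ^ N = 0` for all `x`. -/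
noncomputable def maurerCartanForm (B : E →L[ℝ] E →L[ℝ] E) (N : ℕ) (x : E) : E →L[ℝ] E :=
  ∑ k ∈ Finset.range N, maurerCartanCoeff k • B x ^ k

/-- The curve `t ↦ ∑ k < N, c_k t ^ (k + 1) a_k` with the coefficients `c_k` of the Maurer-Cartan
form. For `a_k = (B x) ^ k v` it is `t` times the form at `t • x` applied to `v`; for the
derivatives of `(B x) ^ k` it is `t ^ 2` times the derivative of the form at `t • x`. -/
noncomputable def maurerCartanCurve (N : ℕ) (a : ℕ → E) (t : ℝ) : E :=
  ∑ k ∈ Finset.range N, (maurerCartanCoeff k * t ^ (k + 1)) • a k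

theorem hasDerivAt_maurerCartanCurve {N : ℕ} {a : ℕ → E} (ha : a N = 0) (t : ℝ) :
    HasDerivAt (maurerCartanCurve N a)
      (a 0 - maurerCartanCurve N (fun k => a (k + 1)) t) t := by
  set b : ℕ → E := fun k => (maurerCartanCoeff k * ((k + 1) * t ^ k)) • a k with hb
  have termwise : HasDerivAt (maurerCartanCurve N a) (∑ k ∈ Finset.range N, b k) t := by
    refine HasDerivAt.fun_sum fun k _ => HasDerivAt.smul_const ?_ _
    simpa using (hasDerivAt_pow (k + 1) t).const_mul (maurerCartanCoeff k)
  have shift (k : ℕ) : (maurerCartanCoeff k * t ^ (k + 1)) • a (k + 1) = -b (k + 1) := by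
    rw [← neg_neg (maurerCartanCoeff k), ← maurerCartanCoeff_succ, hb, ← neg_smul]
    push_cast
    ring_nf
  have telescope := Finset.sum_range_sub' b N
  rw [Finset.sum_sub_distrib, sub_eq_iff_eq_add] at telescope
  convert termwise using 1
  rw [telescope, maurerCartanCurve, Finset.sum_congr rfl fun k _ => shift k,
    Finset.sum_neg_distrib]
  simp [hb, ha, maurerCartanCoeff_zero]

variable {B : E →L[ℝ] E →L[ℝ] E} {N : ℕ}

theorem maurerCartanForm_apply (x v : E) :
    maurerCartanForm B N x v = maurerCartanCurve N (fun k => (B x ^ k) v) 1 := by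
  simp [maurerCartanForm, maurerCartanCurve]

theorem contDiff_maurerCartanForm : ContDiff ℝ ∞ (maurerCartanForm B N) :=
  ContDiff.sum fun k _ => (B.contDiff.pow k).const_smul _

theorem differentiableAt_bracket_pow (k : ℕ) (x : E) :
    DifferentiableAt ℝ (fun y => B y ^ k) x :=
  B.differentiableAt.fun_pow k

theorem fderiv_bracket_pow_succ (k : ℕ) (x v : E) :
    fderiv ℝ (fun y => B y ^ (k + 1)) x v
      = B v * B x ^ k + B x * fderiv ℝ (fun y => B y ^ k) x v := by
  simp only [pow_succ' (B _)]
  rw [fderiv_fun_mul' B.differentiableAt (differentiableAt_bracket_pow k x)]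
  simp [add_comm]

theorem fderiv_maurerCartanForm_apply (x v w : E) :
    fderiv ℝ (maurerCartanForm B N) x v w
      = maurerCartanCurve N (fun k => fderiv ℝ (fun y => B y ^ k) x v w) 1 := by
  have h : HasFDerivAt (maurerCartanForm B N) _ x :=
    HasFDerivAt.fun_sum fun k _ =>
      (differentiableAt_bracket_pow k x).hasFDerivAt.const_smul (maurerCartanCoeff k)
  rw [h.fderiv]
  simp [maurerCartanCurve]

theorem hasDerivAt_maurerCartanCurve_pow (hB : ∀ x, B x ^ N = 0) (x v : E) (t : ℝ) :
    HasDerivAt (maurerCartanCurve N fun k => (B x ^ k) v)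
      (v - B x (maurerCartanCurve N (fun k => (B x ^ k) v) t)) t := by
  have h : (B x ^ N) v = 0 := by rw [hB, zero_apply]
  convert hasDerivAt_maurerCartanCurve (a := fun k => (B x ^ k) v) h t using 1
  simp only [maurerCartanCurve, map_sum, map_smul, pow_succ', mul_apply_eq_comp, pow_zero]
  rfl

theorem hasDerivAt_maurerCartanCurve_fderiv_pow (hB : ∀ x, B x ^ N = 0) (x v w : E) (t : ℝ) :
    HasDerivAt (maurerCartanCurve N fun k => fderiv ℝ (fun y => B y ^ k) x v w)
      (-B v (maurerCartanCurve N (fun k => (B x ^ k) w) t)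
        - B x (maurerCartanCurve N (fun k => fderiv ℝ (fun y => B y ^ k) x v w) t)) t := by
  have h : fderiv ℝ (fun y => B y ^ N) x v w = 0 := by simp only [hB, fderiv_fun_const]; rfl
  convert hasDerivAt_maurerCartanCurve (a := fun k => fderiv ℝ (fun y => B y ^ k) x v w) h t using 1
  simp [maurerCartanCurve, fderiv_bracket_pow_succ, map_sum, Finset.sum_add_distrib,
    sub_eq_neg_add]

/-- `t ^ 2` times the defect of the Maurer-Cartan equation at `t • x` on the vectors `v`, `w`. -/
noncomputable def maurerCartanDefect (B : E →L[ℝ] E →L[ℝ] E) (N : ℕ) (x v w : E) (t : ℝ) : E :=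
  maurerCartanCurve N (fun k => fderiv ℝ (fun y => B y ^ k) x v w) t
    - maurerCartanCurve N (fun k => fderiv ℝ (fun y => B y ^ k) x w v) t
    + B (maurerCartanCurve N (fun k => (B x ^ k) v) t)
        (maurerCartanCurve N (fun k => (B x ^ k) w) t)

theorem hasDerivAt_maurerCartanDefect (skew : ∀ x y, B x y = -B y x)
    (jacobi : ∀ x y z, B x (B y z) = B (B x y) z + B y (B x z))
    (hB : ∀ x, B x ^ N = 0) (x v w : E) (t : ℝ) :
    HasDerivAt (maurerCartanDefect B N x v w) (-B x (maurerCartanDefect B N x v w t)) t := by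
  have hv := hasDerivAt_maurerCartanCurve_pow hB x v t
  have hw := hasDerivAt_maurerCartanCurve_pow hB x w t
  have bracket := (B.hasFDerivAt.comp_hasDerivAt t hv).clm_apply hw
  have exterior := (hasDerivAt_maurerCartanCurve_fderiv_pow hB x v w t).fun_sub
    (hasDerivAt_maurerCartanCurve_fderiv_pow hB x w v t)
  refine (exterior.fun_add bracket).congr_deriv ?_
  simp only [maurerCartanDefect, map_add, map_sub, sub_apply, Function.comp]
  rw [jacobi x (maurerCartanCurve N (fun k => (B x ^ k) v) t),
    skew (maurerCartanCurve N (fun k => (B x ^ k) v) t) w]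
  abel

theorem maurerCartan_equation (skew : ∀ x y, B x y = -B y x)
    (jacobi : ∀ x y z, B x (B y z) = B (B x y) z + B y (B x z))
    (hB : ∀ x, B x ^ N = 0) (x v w : E) :
    fderiv ℝ (maurerCartanForm B N) x v w - fderiv ℝ (maurerCartanForm B N) x w v
      + B (maurerCartanForm B N x v) (maurerCartanForm B N x w) = 0 := by
  -- The defect solves a linear differential equation and vanishes at `t = 0`.
  have vanishes : maurerCartanDefect B N x v w = fun _ => 0 :=
    ODE_solution_unique_univ (v := fun _ y => -B x y) (s := fun _ => Set.univ) (t₀ := 0)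
      (K := ‖B x‖₊) (fun _ => (B x).lipschitz.neg.lipschitzOnWith)
      (fun t => ⟨hasDerivAt_maurerCartanDefect skew jacobi hB x v w t, trivial⟩)
      (fun t => ⟨by simpa using hasDerivAt_const t (0 : E), trivial⟩)
      (by simp [maurerCartanDefect, maurerCartanCurve])
  simpa only [maurerCartanDefect, ← fderiv_maurerCartanForm_apply, ← maurerCartanForm_apply]
    using congrFun vanishes 1

theorem maurerCartanForm_lieBracket (skew : ∀ x y, B x y = -B y x)
    (jacobi : ∀ x y z, B x (B y z) = B (B x y) z + B y (B x z))
    (hB : ∀ x, B x ^ N = 0) {X Y : E → E} {x : E}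
    (hX : DifferentiableAt ℝ X x) (hY : DifferentiableAt ℝ Y x) :
    maurerCartanForm B N x (VectorField.lieBracket ℝ X Y x) =
      B (maurerCartanForm B N x (X x)) (maurerCartanForm B N x (Y x))
      + fderiv ℝ (fun y => maurerCartanForm B N y (Y y)) x (X x)
      - fderiv ℝ (fun y => maurerCartanForm B N y (X y)) x (Y x) := by
  have hd : DifferentiableAt ℝ (maurerCartanForm B N) x :=
    contDiff_maurerCartanForm.differentiable (by simp) x
  rw [fderiv_clm_apply hd hY, fderiv_clm_apply hd hX, VectorField.lieBracket]
  simp only [map_sub, add_apply, ContinuousLinearMap.comp_apply, ContinuousLinearMap.flip_apply]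
  rw [← sub_eq_zero, ← neg_eq_zero, ← maurerCartan_equation skew jacobi hB x (X x) (Y x)]
  abel

theorem isUnit_maurerCartanForm (hB : ∀ x, B x ^ N = 0) (x : E) :
    IsUnit (maurerCartanForm B N x) := by
  cases N with
  | zero =>
    have := subsingleton_of_zero_eq_one (by simpa using (hB x).symm : (0 : E →L[ℝ] E) = 1)
    exact isUnit_of_subsingleton _
  | succ n =>
    have unipotent : maurerCartanForm B (n + 1) x =
        (∑ k ∈ Finset.range n, maurerCartanCoeff (k + 1) • B x ^ k) * B x + 1 := by
      simp [maurerCartanForm, Finset.sum_range_succ', maurerCartanCoeff_zero, Finset.sum_mul,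
        pow_succ]
    rw [unipotent]
    refine (Commute.isNilpotent_mul_left ?_ ⟨n + 1, hB x⟩).isUnit_add_one
    exact Commute.sum_left _ _ _ fun k _ => ((Commute.refl (B x)).pow_left k).smul_left _

end MaurerCartanEquation

section GradedLieAlgebra

theorem eq_of_iSupIndep_of_le_of_iSup_eq_top {α ι : Type*} [CompleteLattice α]
    [IsModularLattice α] {g h : ι → α} (hg : iSupIndep g) (hle : ∀ i, h i ≤ g i)
    (htop : ⨆ i, h i = ⊤) : h = g := by
  funext i
  have complement : Disjoint (g i) (⨆ j, ⨆ (_ : j ≠ i), h j) :=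
    (hg i).mono_right (iSup₂_mono fun j _ => hle j)
  refine eq_of_le_of_inf_le_of_sup_le (hle i) (complement.le_bot.trans bot_le) ?_
  rw [← iSup_split_single h i, htop]
  exact le_top

variable {L : Type*} [LieRing L] [LieAlgebra ℝ L]

/-- The Lie bracket as a bilinear map. -/
def lieBilin (L : Type*) [LieRing L] [LieAlgebra ℝ L] : L →ₗ[ℝ] L →ₗ[ℝ] L :=
  LinearMap.mk₂ ℝ (fun x y => ⁅x, y⁆) add_lie smul_lie lie_add fun c x y => lie_smul c x y

@[simp]
theorem lieBilin_apply (x y : L) : lieBilin L x y = ⁅x, y⁆ := rfl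

/-- The span of the brackets of elements of `S` with elements of `T`. -/
def bracketSpan (S T : Submodule ℝ L) : Submodule ℝ L :=
  Submodule.map₂ (lieBilin L) S T

theorem lie_mem_bracketSpan {S T : Submodule ℝ L} {x y : L} (hx : x ∈ S) (hy : y ∈ T) :
    ⁅x, y⁆ ∈ bracketSpan S T :=
  Submodule.apply_mem_map₂ _ hx hy

theorem bracketSpan_le {S T R : Submodule ℝ L} :
    bracketSpan S T ≤ R ↔ ∀ x ∈ S, ∀ y ∈ T, ⁅x, y⁆ ∈ R :=
  Submodule.map₂_le

theorem lie_mem_bracketSpan_of_mem_lieSpan {S : Submodule ℝ L} {x : L}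
    (hx : x ∈ LieSubalgebra.lieSpan ℝ L (S : Set L)) (y : L) : ⁅x, y⁆ ∈ bracketSpan S ⊤ := by
  induction hx using LieSubalgebra.lieSpan_induction generalizing y with
  | mem x hx => exact lie_mem_bracketSpan hx Submodule.mem_top
  | zero => simp
  | add a b _ _ ha hb => rw [add_lie]; exact add_mem (ha y) (hb y)
  | smul c a _ ha => rw [smul_lie]; exact Submodule.smul_mem _ c (ha y)
  | lie a b _ _ ha hb => rw [lie_lie]; exact sub_mem (ha _) (hb _)

theorem lieSpan_le_sup_bracketSpan (S : Submodule ℝ L) :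
    (LieSubalgebra.lieSpan ℝ L (S : Set L)).toSubmodule ≤ S ⊔ bracketSpan S ⊤ := by
  intro x hx
  induction hx using LieSubalgebra.lieSpan_induction with
  | mem x hx => exact Submodule.mem_sup_left hx
  | zero => exact zero_mem _
  | add a b _ _ ha hb => exact add_mem ha hb
  | smul c a _ ha => exact Submodule.smul_mem _ c ha
  | lie a b ha _ _ _ =>
    exact Submodule.mem_sup_right (lie_mem_bracketSpan_of_mem_lieSpan ha b)

namespace IsFundamentalGNLA

variable {g : ℕ → Submodule ℝ L}

protected theorem iSupIndep (hg : IsFundamentalGNLA g) : iSupIndep g :=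
  hg.internal.submodule_iSupIndep

protected theorem iSup_eq_top (hg : IsFundamentalGNLA g) : ⨆ i, g i = ⊤ :=
  hg.internal.submodule_iSup_eq_top

theorem partialSups_one (hg : IsFundamentalGNLA g) : partialSups g 1 = g 1 := by
  rw [← zero_add 1, partialSups_add_one, partialSups_zero, hg.zero, bot_sup_eq]

theorem disjoint_partialSups (hg : IsFundamentalGNLA g) {i k : ℕ} (h : k < i) :
    Disjoint (partialSups g k) (g i) := by
  rw [partialSups_eq_biSup, disjoint_comm]
  exact hg.iSupIndep.disjoint_biSup (not_le.2 h)

theorem lie_mem_partialSups (hg : IsFundamentalGNLA g) {k : ℕ} {x y : L} (hx : x ∈ g 1)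
    (hy : y ∈ partialSups g k) : ⁅x, y⁆ ∈ partialSups g (k + 1) := by
  suffices partialSups g k ≤
      (partialSups g (k + 1)).comap (lieBilin L x) from this hy
  refine partialSups_le _ _ _ fun i hi y hy => ?_
  exact le_partialSups_of_le g (by omega : 1 + i ≤ k + 1) (hg.lie_mem 1 i x y hx hy)

theorem finrank_partialSups_add_one (hg : IsFundamentalGNLA g) (k : ℕ) :
    Module.finrank ℝ (partialSups g (k + 1) : Submodule ℝ L) =
      Module.finrank ℝ (partialSups g k : Submodule ℝ L) + Module.finrank ℝ (g (k + 1)) := by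
  have := hg.finite
  rw [partialSups_add_one, ← Submodule.finrank_sup_add_finrank_inf_eq,
    (hg.disjoint_partialSups k.lt_succ_self).eq_bot, finrank_bot, add_zero]

theorem exists_forall_lt_eq_bot (hg : IsFundamentalGNLA g) : ∃ μ, ∀ i, μ < i → g i = ⊥ := by
  have := hg.finite
  obtain ⟨μ, hμ⟩ := (WellFoundedGT.finite_ne_bot_of_iSupIndep hg.iSupIndep).bddAbove
  exact ⟨μ, fun i hi => by_contra fun h => (hμ h).not_gt hi⟩

theorem partialSups_eq_top (hg : IsFundamentalGNLA g) {μ : ℕ} (hμ : ∀ i, μ < i → g i = ⊥) :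
    partialSups g μ = ⊤ := by
  rw [eq_top_iff, ← hg.iSup_eq_top]
  refine iSup_le fun i => ?_
  rcases le_or_gt i μ with h | h
  · exact le_partialSups_of_le g h
  · exact (hμ i h).trans_le bot_le

theorem bracketSpan_eq (hg : IsFundamentalGNLA g) (k : ℕ) :
    bracketSpan (g 1) (g (k + 1)) = g (k + 2) := by
  let h : ℕ → Submodule ℝ L
    | 0 => ⊥
    | 1 => g 1
    | i + 2 => bracketSpan (g 1) (g (i + 1))
  have hle : ∀ i, h i ≤ g i
    | 0 => bot_le
    | 1 => le_rfl
    | i + 2 => bracketSpan_le.2 fun x hx y hy => by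
        simpa only [add_comm 1, add_assoc] using hg.lie_mem 1 (i + 1) x y hx hy
  have bracketSpan_le_iSup : bracketSpan (g 1) ⊤ ≤ ⨆ i, h i := by
    rw [← hg.iSup_eq_top, bracketSpan, Submodule.map₂_iSup_right]
    refine iSup_le fun i => ?_
    cases i with
    | zero => simp [hg.zero]
    | succ i => exact le_iSup h (i + 2)
  have htop : ⨆ i, h i = ⊤ := by
    refine top_le_iff.1 (le_trans ?_ (sup_le (le_iSup h 1) bracketSpan_le_iSup))
    simpa [hg.generates] using lieSpan_le_sup_bracketSpan (g 1)
  exact congrFun (eq_of_iSupIndep_of_le_of_iSup_eq_top hg.iSupIndep hle htop) (k + 2)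

theorem sup_bracketSpan_partialSups (hg : IsFundamentalGNLA g) (k : ℕ) :
    partialSups g (k + 1) ⊔ bracketSpan (g 1) (partialSups g (k + 1)) = partialSups g (k + 2) := by
  refine le_antisymm (sup_le (partialSups_monotone g (Nat.le_succ _))
    (bracketSpan_le.2 fun x hx y hy => hg.lie_mem_partialSups hx hy)) ?_
  refine (partialSups_add_one g (k + 1)).trans_le ?_
  exact sup_le_sup_left ((hg.bracketSpan_eq k).ge.trans
    (Submodule.map₂_le_map₂_right (le_partialSups g (k + 1)))) _

theorem lie_mem_iSup_add (hg : IsFundamentalGNLA g) (x : L) {n : ℕ} {y : L}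
    (hy : y ∈ ⨆ i, g (n + i)) : ⁅x, y⁆ ∈ ⨆ i, g (n + 1 + i) := by
  have hx : x ∈ ⨆ i, g i := hg.iSup_eq_top ▸ Submodule.mem_top
  induction hx using Submodule.iSup_induction' with
  | mem j x hx =>
    suffices ⨆ i, g (n + i) ≤
        (⨆ i, g (n + 1 + i)).comap (lieBilin L x) from this hy
    refine iSup_le fun i y hy => ?_
    cases j with
    | zero =>
      obtain rfl : x = 0 := by simpa [hg.zero] using hx
      simp
    | succ j =>
      have h := hg.lie_mem (j + 1) (n + i) x y hx hy
      rw [show j + 1 + (n + i) = n + 1 + (j + i) by ring] at h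
      exact Submodule.mem_iSup_of_mem (j + i) h
  | zero => simp
  | add a b _ _ ha hb => rw [add_lie]; exact add_mem ha hb

theorem ad_pow_mem_iSup_add (hg : IsFundamentalGNLA g) (x y : L) (n : ℕ) :
    (LieAlgebra.ad ℝ L x ^ n) y ∈ ⨆ i, g (n + i) := by
  induction n with
  | zero => simp [hg.iSup_eq_top]
  | succ n ih => exact pow_succ' (LieAlgebra.ad ℝ L x) n ▸ hg.lie_mem_iSup_add x ih

theorem ad_pow_finrank (hg : IsFundamentalGNLA g) (x : L) :
    LieAlgebra.ad ℝ L x ^ Module.finrank ℝ L = 0 := by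
  have := hg.finite
  obtain ⟨μ, hμ⟩ := hg.exists_forall_lt_eq_bot
  ext y
  have nilpotent : (LieAlgebra.ad ℝ L x ^ (μ + 1)) y = 0 := by
    have h := hg.ad_pow_mem_iSup_add x y (μ + 1)
    simpa [fun i => hμ (μ + 1 + i) (by omega)] using h
  exact Module.End.ker_pow_le_ker_pow_finrank (K := ℝ) _ (μ + 1) nilpotent

end IsFundamentalGNLA

end GradedLieAlgebra

section WeakFlag

variable {E : Type*} [NormedAddCommGroup E] [NormedSpace ℝ E]
  {M : Type*} [TopologicalSpace M] [ChartedSpace E M] [IsManifold 𝓘(ℝ, E) ∞ M]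
  {Δ : ∀ x : M, Submodule ℝ (TangentSpace 𝓘(ℝ, E) x)} {X Y : ∀ x : M, TangentSpace 𝓘(ℝ, E) x}
  {x : M} {i : ℕ}

theorem IsLocalSection.mem (hX : IsLocalSection Δ x X) : X x ∈ Δ x := by
  obtain ⟨U, -, hxU, -, hmem⟩ := hX
  exact hmem x hxU

theorem IsLocalSection.mdifferentiableAt (hX : IsLocalSection Δ x X) :
    MDifferentiableAt 𝓘(ℝ, E) (𝓘(ℝ, E)).tangent
      (fun y => (⟨y, X y⟩ : TangentBundle 𝓘(ℝ, E) M)) x := by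
  obtain ⟨U, hU, hxU, hXs, -⟩ := hX
  exact (hXs.contMDiffAt (hU.mem_nhds hxU)).mdifferentiableAt (by simp)

theorem weakFlag_monotone (Δ : ∀ x : M, Submodule ℝ (TangentSpace 𝓘(ℝ, E) x)) (x : M) :
    Monotone fun i => weakFlag Δ i x :=
  monotone_nat_of_le_succ fun
    | 0 => bot_le
    | _ + 1 => le_sup_left

theorem mlieBracket_mem_weakFlag (hX : IsLocalSection Δ x X)
    (hY : IsLocalSection (weakFlag Δ (i + 1)) x Y) :
    VectorField.mlieBracket 𝓘(ℝ, E) X Y x ∈ weakFlag Δ (i + 2) x :=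
  Submodule.mem_sup_right (Submodule.subset_span ⟨X, Y, hX, hY, rfl⟩)

theorem weakFlag_add_two_le {S : Submodule ℝ (TangentSpace 𝓘(ℝ, E) x)}
    (h : weakFlag Δ (i + 1) x ≤ S)
    (hbracket : ∀ X Y : ∀ y : M, TangentSpace 𝓘(ℝ, E) y, IsLocalSection Δ x X →
      IsLocalSection (weakFlag Δ (i + 1)) x Y → VectorField.mlieBracket 𝓘(ℝ, E) X Y x ∈ S) :
    weakFlag Δ (i + 2) x ≤ S := by
  refine sup_le h (Submodule.span_le.2 ?_)
  rintro _ ⟨X, Y, hX, hY, rfl⟩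
  exact hbracket X Y hX hY

end WeakFlag

section VectorFields

variable {E : Type*} [NormedAddCommGroup E] [NormedSpace ℝ E]

theorem mlieBracket_eq_lieBracket (X Y : E → E) (x : E) :
    VectorField.mlieBracket 𝓘(ℝ, E) X Y x = VectorField.lieBracket ℝ X Y x :=
  (congrFun VectorField.mlieBracketWithin_univ x).symm.trans
    ((congrFun VectorField.mlieBracketWithin_eq_lieBracketWithin x).trans
      (congrFun VectorField.lieBracketWithin_univ x))

theorem SmoothOn.contDiffAt {X : E → E} {U : Set E} (hX : SmoothOn (M := E) X U)
    (hU : IsOpen U) {x : E} (hx : x ∈ U) : ContDiffAt ℝ ∞ X x :=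
  (contMDiffOn_vectorSpace_iff_contDiffOn.1 hX).contDiffAt (hU.mem_nhds hx)

theorem fderiv_mem_of_eventually_mem {F : Type*} [NormedAddCommGroup F] [NormedSpace ℝ F]
    {f : E → F} {x : E} {S : Submodule ℝ F} (hS : IsClosed (S : Set F))
    (hf : DifferentiableAt ℝ f x) (h : ∀ᶠ y in 𝓝 x, f y ∈ S) (v : E) : fderiv ℝ f x v ∈ S := by
  refine hS.mem_of_tendsto (hf.hasFDerivAt.hasLineDerivAt v).tendsto_slope_zero ?_
  have along_line : Filter.Tendsto (fun t : ℝ => x + t • v) (𝓝[≠] 0) (𝓝 x) := by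
    have : Continuous fun t : ℝ => x + t • v := by fun_prop
    simpa using (this.tendsto 0).mono_left nhdsWithin_le_nhds
  filter_upwards [along_line h] with t ht
  exact S.smul_mem _ (S.sub_mem (by simpa using ht) (by simpa using h.self_of_nhds))

theorem IsLocalSection.differentiableAt {Δ : ∀ x : E, Submodule ℝ (TangentSpace 𝓘(ℝ, E) x)}
    {X : E → E} {x : E} (hX : IsLocalSection Δ x X) : DifferentiableAt ℝ X x := by
  obtain ⟨U, hU, hxU, hXU, -⟩ := hX
  exact (hXU.contDiffAt hU hxU).differentiableAt (by simp)

end VectorFields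

section StandardModel

variable {L : Type*} [LieRing L] [LieAlgebra ℝ L] {g : ℕ → Submodule ℝ L}
  {E : Type*} [NormedAddCommGroup E] [NormedSpace ℝ E] [FiniteDimensional ℝ E]

/-- The Lie bracket of `L` in the linear coordinates `e`. -/
noncomputable def coordBracket (e : E ≃ₗ[ℝ] L) : E →L[ℝ] E →L[ℝ] E :=
  LinearMap.toContinuousBilinearMap
    (((lieBilin L).compl₁₂ e.toLinearMap e.toLinearMap).compr₂ e.symm.toLinearMap)

theorem coordBracket_apply (e : E ≃ₗ[ℝ] L) (x y : E) :
    coordBracket e x y = e.symm ⁅e x, e y⁆ := by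
  simp [coordBracket]

theorem coordBracket_skew (e : E ≃ₗ[ℝ] L) (x y : E) :
    coordBracket e x y = -coordBracket e y x := by
  rw [coordBracket_apply, coordBracket_apply, ← lie_skew, map_neg]

theorem coordBracket_jacobi (e : E ≃ₗ[ℝ] L) (x y z : E) :
    coordBracket e x (coordBracket e y z) =
      coordBracket e (coordBracket e x y) z + coordBracket e y (coordBracket e x z) := by
  simp only [coordBracket_apply, LinearEquiv.apply_symm_apply]
  rw [leibniz_lie, map_add]

theorem coordBracket_pow_apply (e : E ≃ₗ[ℝ] L) (x v : E) (k : ℕ) :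
    e ((coordBracket e x ^ k) v) = (LieAlgebra.ad ℝ L (e x) ^ k) (e v) := by
  induction k with
  | zero => simp
  | succ k ih =>
    simp only [pow_succ', mul_apply_eq_comp, Module.End.mul_apply, coordBracket_apply,
      LinearEquiv.apply_symm_apply, ih, LieAlgebra.ad_apply]

theorem IsFundamentalGNLA.coordBracket_pow (hg : IsFundamentalGNLA g) (e : E ≃ₗ[ℝ] L) (x : E) :
    coordBracket e x ^ Module.finrank ℝ L = 0 := by
  ext v
  apply e.injective
  rw [coordBracket_pow_apply, hg.ad_pow_finrank, LinearMap.zero_apply, zero_apply, map_zero]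

/-- The left-invariant Maurer-Cartan form in the linear coordinates `e`. -/
noncomputable def coordForm (e : E ≃ₗ[ℝ] L) : E → E →L[ℝ] E :=
  maurerCartanForm (coordBracket e) (Module.finrank ℝ L)

theorem coordForm_apply (e : E ≃ₗ[ℝ] L) (x v : E) :
    e (coordForm e x v) = maurerCartan (e x) (e v) := by
  simp only [coordForm, maurerCartanForm, maurerCartan, maurerCartanCoeff, sum_apply, smul_apply,
    LinearMap.coe_sum, Finset.sum_apply, LinearMap.smul_apply, map_sum, map_smul,
    coordBracket_pow_apply]

theorem contDiff_coordForm (e : E ≃ₗ[ℝ] L) : ContDiff ℝ ∞ (coordForm e) :=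
  contDiff_maurerCartanForm

theorem isUnit_coordForm (hg : IsFundamentalGNLA g) (e : E ≃ₗ[ℝ] L) (x : E) :
    IsUnit (coordForm e x) :=
  isUnit_maurerCartanForm (hg.coordBracket_pow e) x

/-- The identification of the tangent space at `x` with the Lie algebra by left translation. -/
noncomputable def coframe (hg : IsFundamentalGNLA g) (e : E ≃ₗ[ℝ] L) (x : E) : E ≃ₗ[ℝ] L :=
  (ContinuousLinearEquiv.unitsEquiv ℝ E (isUnit_coordForm hg e x).unit).toLinearEquiv.trans e

variable (hg : IsFundamentalGNLA g) (e : E ≃ₗ[ℝ] L)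

theorem coframe_apply (x v : E) : coframe hg e x v = e (coordForm e x v) := rfl

/-- The left-invariant vector field with value `a` at the identity. -/
noncomputable def leftInvariantField (a : L) (x : E) : E := (coframe hg e x).symm a

theorem coframe_leftInvariantField (a : L) (x : E) :
    coframe hg e x (leftInvariantField hg e a x) = a :=
  (coframe hg e x).apply_symm_apply a

theorem leftInvariantField_coframe (x v : E) :
    leftInvariantField hg e (coframe hg e x v) x = v :=
  (coframe hg e x).symm_apply_apply v

theorem coordForm_leftInvariantField (a : L) (x : E) :
    coordForm e x (leftInvariantField hg e a x) = e.symm a :=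
  (LinearEquiv.eq_symm_apply e).2 (coframe_leftInvariantField hg e a x)

theorem contDiff_leftInvariantField (a : L) : ContDiff ℝ ∞ (leftInvariantField hg e a) := by
  have := FiniteDimensional.complete ℝ E
  have eq_inverse :
      leftInvariantField hg e a = fun x => Ring.inverse (coordForm e x) (e.symm a) := by
    funext x
    rw [← coordForm_leftInvariantField hg e a x, ← mul_apply_eq_comp,
      Ring.inverse_mul_cancel _ (isUnit_coordForm hg e x), one_apply_eq_self]
  rw [eq_inverse, contDiff_iff_contDiffAt]
  intro x
  obtain ⟨u, hu⟩ := isUnit_coordForm hg e x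
  have h := (contDiffAt_ringInverse (n := ∞) ℝ u)
  rw [hu] at h
  exact (h.comp x (contDiff_coordForm e).contDiffAt).clm_apply contDiffAt_const

theorem smoothOn_leftInvariantField (a : L) (U : Set E) :
    SmoothOn (M := E) (leftInvariantField hg e a) U :=
  contMDiffOn_vectorSpace_iff_contDiffOn.2 (contDiff_leftInvariantField hg e a).contDiffOn

theorem coframe_lieBracket {X Y : E → E} {x : E}
    (hX : DifferentiableAt ℝ X x) (hY : DifferentiableAt ℝ Y x) :
    coframe hg e x (VectorField.lieBracket ℝ X Y x) =
      ⁅coframe hg e x (X x), coframe hg e x (Y x)⁆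
      + e (fderiv ℝ (fun y => coordForm e y (Y y)) x (X x))
      - e (fderiv ℝ (fun y => coordForm e y (X y)) x (Y x)) := by
  have h : coordForm e x (VectorField.lieBracket ℝ X Y x) = _ :=
    maurerCartanForm_lieBracket (coordBracket_skew e) (coordBracket_jacobi e)
      (hg.coordBracket_pow e) hX hY
  rw [coframe_apply, h, map_sub, map_add, coordBracket_apply, LinearEquiv.apply_symm_apply]
  rfl

theorem lieBracket_leftInvariantField (a b : L) (x : E) :
    VectorField.lieBracket ℝ (leftInvariantField hg e a) (leftInvariantField hg e b) x =
      leftInvariantField hg e ⁅a, b⁆ x := by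
  have hd (a) : DifferentiableAt ℝ (leftInvariantField hg e a) x :=
    (contDiff_leftInvariantField hg e a).differentiable (by simp) x
  refine (coframe hg e x).injective ?_
  rw [coframe_lieBracket hg e (hd a) (hd b)]
  simp [coframe_leftInvariantField, coordForm_leftInvariantField]

/-- The left-invariant distribution with value `S` at the identity. -/
noncomputable def leftInvariantDistribution (S : Submodule ℝ L) (x : E) :
    Submodule ℝ (TangentSpace 𝓘(ℝ, E) x) :=
  S.comap (coframe hg e x).toLinearMap

theorem mem_leftInvariantDistribution {S : Submodule ℝ L} {x : E} {v : TangentSpace 𝓘(ℝ, E) x} :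
    v ∈ leftInvariantDistribution hg e S x ↔ coframe hg e x v ∈ S :=
  Iff.rfl

theorem leftInvariantDistribution_bot : leftInvariantDistribution hg e ⊥ = fun _ => ⊥ :=
  funext fun x => (coframe hg e x).ker

theorem leftInvariantDistribution_mono {S T : Submodule ℝ L} (h : S ≤ T) (x : E) :
    leftInvariantDistribution hg e S x ≤ leftInvariantDistribution hg e T x :=
  Submodule.comap_mono h

theorem finrank_leftInvariantDistribution (S : Submodule ℝ L) (x : E) :
    Module.finrank ℝ (leftInvariantDistribution hg e S x) = Module.finrank ℝ S := by
  have h := LinearEquiv.finrank_map_eq (coframe hg e x) (S.comap (coframe hg e x).toLinearMap)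
  rw [Submodule.map_comap_eq_of_surjective (coframe hg e x).surjective] at h
  exact h.symm

theorem standardDistribution_eq (hg : IsFundamentalGNLA g) (e : E ≃ₗ[ℝ] L) :
    standardDistribution g e = leftInvariantDistribution hg e (g 1) := by
  funext x
  ext v
  exact iff_of_eq (congrArg (· ∈ g 1) (coordForm_apply e x v).symm)

theorem leftInvariantField_mem {S : Submodule ℝ L} {a : L} (ha : a ∈ S) (x : E) :
    leftInvariantField hg e a x ∈ leftInvariantDistribution hg e S x := by
  refine (mem_leftInvariantDistribution hg e).2 ?_
  rwa [coframe_leftInvariantField]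

theorem isLocalSection_leftInvariantField {S : Submodule ℝ L} {a : L} (ha : a ∈ S) (x : E) :
    IsLocalSection (leftInvariantDistribution hg e S) x (leftInvariantField hg e a) :=
  ⟨Set.univ, isOpen_univ, trivial, smoothOn_leftInvariantField hg e a _, fun y _ =>
    leftInvariantField_mem hg e ha y⟩

theorem fderiv_coordForm_mem {S : Submodule ℝ L} {X : E → E} {x : E}
    (hX : IsLocalSection (leftInvariantDistribution hg e S) x X) (v : E) :
    e (fderiv ℝ (fun y => coordForm e y (X y)) x v) ∈ S := by
  obtain ⟨U, hU, hxU, hXU, hmem⟩ := hX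
  have smooth := (contDiff_coordForm e).contDiffAt.clm_apply (hXU.contDiffAt hU hxU)
  exact fderiv_mem_of_eventually_mem (S := S.comap e.toLinearMap)
    (Submodule.closed_of_finiteDimensional _) (smooth.differentiableAt (by simp))
    (Filter.eventually_of_mem (hU.mem_nhds hxU) hmem) v

theorem mlieBracket_mem_leftInvariantDistribution {S T R : Submodule ℝ L} {X Y : E → E} {x : E}
    (hX : IsLocalSection (leftInvariantDistribution hg e S) x X)
    (hY : IsLocalSection (leftInvariantDistribution hg e T) x Y)
    (hS : S ≤ R) (hT : T ≤ R) (hST : bracketSpan S T ≤ R) :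
    VectorField.mlieBracket 𝓘(ℝ, E) X Y x ∈ leftInvariantDistribution hg e R x := by
  rw [mlieBracket_eq_lieBracket]
  refine (mem_leftInvariantDistribution hg e).2 ?_
  rw [coframe_lieBracket hg e hX.differentiableAt hY.differentiableAt]
  exact sub_mem (add_mem (hST (lie_mem_bracketSpan hX.mem hY.mem))
    (hT (fderiv_coordForm_mem hg e hY _))) (hS (fderiv_coordForm_mem hg e hX _))

theorem leftInvariantField_lie_mem_weakFlag {Δ : ∀ x : E, Submodule ℝ (TangentSpace 𝓘(ℝ, E) x)}
    {S T : Submodule ℝ L} {i : ℕ} (hΔ : Δ = leftInvariantDistribution hg e S)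
    (ih : weakFlag Δ (i + 1) = leftInvariantDistribution hg e T) {a b : L} (ha : a ∈ S)
    (hb : b ∈ T) (x : E) : leftInvariantField hg e ⁅a, b⁆ x ∈ weakFlag Δ (i + 2) x := by
  have h := mlieBracket_mem_weakFlag (hΔ ▸ isLocalSection_leftInvariantField hg e ha x)
    (ih ▸ isLocalSection_leftInvariantField hg e hb x)
  exact (lieBracket_leftInvariantField hg e a b x) ▸
    (mlieBracket_eq_lieBracket (leftInvariantField hg e a) (leftInvariantField hg e b) x) ▸ h

theorem weakFlag_leftInvariantDistribution_add_two
    {Δ : ∀ x : E, Submodule ℝ (TangentSpace 𝓘(ℝ, E) x)} {S T : Submodule ℝ L} {i : ℕ}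
    (hΔ : Δ = leftInvariantDistribution hg e S)
    (ih : weakFlag Δ (i + 1) = leftInvariantDistribution hg e T) (hST : S ≤ T) :
    weakFlag Δ (i + 2) = leftInvariantDistribution hg e (T ⊔ bracketSpan S T) := by
  funext x
  refine le_antisymm (weakFlag_add_two_le ?_ fun X Y hX hY => ?_) ?_
  · rw [ih]
    exact leftInvariantDistribution_mono hg e le_sup_left x
  · rw [ih] at hY
    rw [hΔ] at hX
    exact mlieBracket_mem_leftInvariantDistribution hg e hX hY (hST.trans le_sup_left)
      le_sup_left le_sup_right
  · suffices T ⊔ bracketSpan S T ≤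
        (weakFlag Δ (i + 2) x).comap (coframe hg e x).symm.toLinearMap from fun v hv =>
      leftInvariantField_coframe hg e x v ▸ this hv
    refine sup_le (fun a ha => weakFlag_monotone Δ x (Nat.le_succ (i + 1)) ?_)
      (bracketSpan_le.2 fun a ha b hb => leftInvariantField_lie_mem_weakFlag hg e hΔ ih ha hb x)
    exact (congrFun ih x).ge (leftInvariantField_mem hg e ha x)

theorem weakFlag_standardDistribution (hg : IsFundamentalGNLA g) (e : E ≃ₗ[ℝ] L) (k : ℕ) :
    weakFlag (standardDistribution g e) k = leftInvariantDistribution hg e (partialSups g k) := by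
  induction k using Nat.twoStepInduction with
  | zero => rw [partialSups_zero, hg.zero, leftInvariantDistribution_bot]; rfl
  | one => rw [hg.partialSups_one]; exact standardDistribution_eq hg e
  | more i _ ih =>
    rw [weakFlag_leftInvariantDistribution_add_two hg e (standardDistribution_eq hg e) ih
      (le_partialSups_of_le g (by omega)), hg.sup_bracketSpan_partialSups]

theorem finrank_weakFlag_standardDistribution (hg : IsFundamentalGNLA g) (e : E ≃ₗ[ℝ] L)
    (k : ℕ) (x : E) :
    Module.finrank ℝ (weakFlag (standardDistribution g e) k x) =
      Module.finrank ℝ (partialSups g k : Submodule ℝ L) := by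
  rw [weakFlag_standardDistribution hg, finrank_leftInvariantDistribution]

theorem completelyNonholonomic_standardDistribution (hg : IsFundamentalGNLA g) (e : E ≃ₗ[ℝ] L) :
    CompletelyNonholonomic (standardDistribution g e) := by
  obtain ⟨μ, hμ⟩ := hg.exists_forall_lt_eq_bot
  refine ⟨μ, fun x => ?_⟩
  rw [weakFlag_standardDistribution hg, hg.partialSups_eq_top hμ]
  rfl

theorem isDistribution_standardDistribution (hg : IsFundamentalGNLA g) (e : E ≃ₗ[ℝ] L) :
    IsDistribution (standardDistribution g e) (Module.finrank ℝ (g 1)) := by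
  have := hg.finite
  let b := Module.finBasis ℝ (g 1)
  refine fun p => ⟨Set.univ, isOpen_univ, trivial, fun j => leftInvariantField hg e (b j),
    fun j => smoothOn_leftInvariantField hg e _ _, fun x _ => ⟨?_, ?_⟩⟩
  · exact b.linearIndependent.map' ((coframe hg e x).symm.toLinearMap ∘ₗ (g 1).subtype)
      (LinearMap.ker_eq_bot.2 ((coframe hg e x).symm.injective.comp (g 1).subtype_injective))
  · have h := congrArg (Submodule.map ((coframe hg e x).symm.toLinearMap ∘ₗ (g 1).subtype))
      b.span_eq
    rw [Submodule.map_span, ← Set.range_comp, Submodule.map_top, LinearMap.range_comp,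
      Submodule.range_subtype] at h
    rw [standardDistribution_eq hg]
    exact (Submodule.map_equiv_eq_comap_symm (coframe hg e x).symm (g 1)).symm.trans h.symm

end StandardModel

section LocalEquivalence

variable {E : Type*} [NormedAddCommGroup E] [NormedSpace ℝ E]
  {M : Type*} [TopologicalSpace M] [ChartedSpace E M]
  {E' : Type*} [NormedAddCommGroup E'] [NormedSpace ℝ E']
  {M' : Type*} [TopologicalSpace M'] [ChartedSpace E' M']
  {E'' : Type*} [NormedAddCommGroup E''] [NormedSpace ℝ E'']
  {M'' : Type*} [TopologicalSpace M''] [ChartedSpace E'' M'']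

/-- The diffeomorphism `φ` between open subsets carries `Δ` to `Δ'`. Local equivalences are
the existence of such a `φ`, which this structure allows to compose and to invert. -/
structure Carries (φ : OpenPartialHomeomorph M M')
    (Δ : ∀ x : M, Submodule ℝ (TangentSpace 𝓘(ℝ, E) x))
    (Δ' : ∀ x : M', Submodule ℝ (TangentSpace 𝓘(ℝ, E') x)) : Prop where
  smooth : ContMDiffOn 𝓘(ℝ, E) 𝓘(ℝ, E') ∞ φ φ.source
  smooth_symm : ContMDiffOn 𝓘(ℝ, E') 𝓘(ℝ, E) ∞ φ.symm φ.target
  map_eq : ∀ x ∈ φ.source,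
      Δ' (φ x) = (Δ x).map (mfderiv 𝓘(ℝ, E) 𝓘(ℝ, E') φ x).toLinearMap

theorem locallyEquivalentAt_iff {Δ : ∀ x : M, Submodule ℝ (TangentSpace 𝓘(ℝ, E) x)} {p : M}
    {Δ' : ∀ x : M', Submodule ℝ (TangentSpace 𝓘(ℝ, E') x)} :
    LocallyEquivalentAt Δ p Δ' ↔
      ∃ φ : OpenPartialHomeomorph M M', p ∈ φ.source ∧ Carries φ Δ Δ' :=
  ⟨fun ⟨φ, hp, h1, h2, h3⟩ => ⟨φ, hp, h1, h2, h3⟩,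
    fun ⟨φ, hp, h⟩ => ⟨φ, hp, h.smooth, h.smooth_symm, h.map_eq⟩⟩

namespace Carries

variable {φ : OpenPartialHomeomorph M M'} {ψ : OpenPartialHomeomorph M' M''}
  {Δ : ∀ x : M, Submodule ℝ (TangentSpace 𝓘(ℝ, E) x)}
  {Δ' : ∀ x : M', Submodule ℝ (TangentSpace 𝓘(ℝ, E') x)}
  {Δ'' : ∀ x : M'', Submodule ℝ (TangentSpace 𝓘(ℝ, E'') x)}

theorem mdifferentiable (h : Carries φ Δ Δ') : φ.MDifferentiable 𝓘(ℝ, E) 𝓘(ℝ, E') :=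
  ⟨h.smooth.mdifferentiableOn (by simp), h.smooth_symm.mdifferentiableOn (by simp)⟩

theorem symm (h : Carries φ Δ Δ') : Carries φ.symm Δ' Δ where
  smooth := h.smooth_symm
  smooth_symm := h.smooth
  map_eq y hy := by
    have map_eq := h.map_eq _ (φ.map_target hy)
    have comp_eq := h.mdifferentiable.symm_comp_deriv (φ.map_target hy)
    rw [φ.right_inv hy] at map_eq comp_eq
    rw [map_eq, ← Submodule.map_comp]
    exact ((congrArg (fun T : TangentSpace 𝓘(ℝ, E) (φ.symm y) →L[ℝ]
      TangentSpace 𝓘(ℝ, E) (φ.symm y) => (Δ (φ.symm y)).map T.toLinearMap) comp_eq).trans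
      (Submodule.map_id _)).symm

theorem trans (h : Carries φ Δ Δ') (h' : Carries ψ Δ' Δ'') : Carries (φ.trans ψ) Δ Δ'' where
  smooth := h'.smooth.comp' h.smooth
  smooth_symm := h.smooth_symm.comp' h'.smooth_symm
  map_eq x hx := by
    rw [OpenPartialHomeomorph.trans_source] at hx
    have comp_eq : mfderiv 𝓘(ℝ, E) 𝓘(ℝ, E'') (ψ ∘ φ) x = _ :=
      mfderiv_comp x (h'.mdifferentiable.mdifferentiableAt hx.2)
        (h.mdifferentiable.mdifferentiableAt hx.1)
    have map_eq := h'.map_eq (φ x) hx.2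
    rw [h.map_eq x hx.1, ← Submodule.map_comp] at map_eq
    rw [OpenPartialHomeomorph.coe_trans, comp_eq]
    exact map_eq

theorem contMDiffAt (h : Carries φ Δ Δ') {x : M} (hx : x ∈ φ.source) :
    ContMDiffAt 𝓘(ℝ, E) 𝓘(ℝ, E') ∞ φ x :=
  h.smooth.contMDiffAt (φ.open_source.mem_nhds hx)

theorem isInvertible (h : Carries φ Δ Δ') {x : M} (hx : x ∈ φ.source) :
    (mfderiv 𝓘(ℝ, E) 𝓘(ℝ, E') φ x).IsInvertible :=
  ⟨h.mdifferentiable.mfderiv hx, rfl⟩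

theorem inverse_mem (h : Carries φ Δ Δ') {x : M} (hx : x ∈ φ.source)
    {v : TangentSpace 𝓘(ℝ, E') (φ x)} (hv : v ∈ Δ' (φ x)) :
    (mfderiv 𝓘(ℝ, E) 𝓘(ℝ, E') φ x).inverse v ∈ Δ x := by
  rw [h.map_eq x hx] at hv
  obtain ⟨w, hw, rfl⟩ := hv
  exact (h.isInvertible hx).inverse_apply_eq.2 rfl ▸ hw

theorem finrank_eq (h : Carries φ Δ Δ') {x : M} (hx : x ∈ φ.source) :
    Module.finrank ℝ (Δ' (φ x)) = Module.finrank ℝ (Δ x) := by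
  rw [h.map_eq x hx]
  exact LinearEquiv.finrank_map_eq (h.mdifferentiable.mfderiv hx).toLinearEquiv (Δ x)

variable [IsManifold 𝓘(ℝ, E) ∞ M] [IsManifold 𝓘(ℝ, E') ∞ M'] [CompleteSpace E]

theorem isLocalSection_mpullback (h : Carries φ Δ Δ')
    {D : ∀ x : M, Submodule ℝ (TangentSpace 𝓘(ℝ, E) x)}
    {D' : ∀ x : M', Submodule ℝ (TangentSpace 𝓘(ℝ, E') x)}
    (hD : ∀ x ∈ φ.source, ∀ v ∈ D' (φ x), (mfderiv 𝓘(ℝ, E) 𝓘(ℝ, E') φ x).inverse v ∈ D x)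
    {x : M} (hx : x ∈ φ.source) {X : ∀ y : M', TangentSpace 𝓘(ℝ, E') y}
    (hX : IsLocalSection D' (φ x) X) :
    IsLocalSection D x (VectorField.mpullback 𝓘(ℝ, E) 𝓘(ℝ, E') φ X) := by
  obtain ⟨U, hU, hxU, hXs, hXD⟩ := hX
  refine ⟨φ.source ∩ φ ⁻¹' U, φ.isOpen_inter_preimage hU, ⟨hx, hxU⟩, fun y hy => ?_,
    fun y hy => hD y hy.1 _ (hXD _ hy.2)⟩
  exact ((hXs.contMDiffAt (hU.mem_nhds hy.2)).mpullback_vectorField_preimage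
    (h.contMDiffAt hy.1) (h.isInvertible hy.1) (by simp)).contMDiffWithinAt

theorem mpullback_mlieBracket (h : Carries φ Δ Δ')
    {D D' : ∀ x : M', Submodule ℝ (TangentSpace 𝓘(ℝ, E') x)} {x : M} (hx : x ∈ φ.source)
    {X Y : ∀ y : M', TangentSpace 𝓘(ℝ, E') y}
    (hX : IsLocalSection D (φ x) X) (hY : IsLocalSection D' (φ x) Y) :
    (mfderiv 𝓘(ℝ, E) 𝓘(ℝ, E') φ x).inverse (VectorField.mlieBracket 𝓘(ℝ, E') X Y (φ x)) =
      VectorField.mlieBracket 𝓘(ℝ, E) (VectorField.mpullback 𝓘(ℝ, E) 𝓘(ℝ, E') φ X)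
        (VectorField.mpullback 𝓘(ℝ, E) 𝓘(ℝ, E') φ Y) x := by
  have : IsManifold 𝓘(ℝ, E) (minSmoothness ℝ 2) M := by
    rw [minSmoothness_of_isRCLikeNormedField]; infer_instance
  have : IsManifold 𝓘(ℝ, E') (minSmoothness ℝ 2) M' := by
    rw [minSmoothness_of_isRCLikeNormedField]; infer_instance
  exact VectorField.mpullback_mlieBracket hX.mdifferentiableAt hY.mdifferentiableAt
    (h.contMDiffAt hx) (by rw [minSmoothness_of_isRCLikeNormedField]; norm_cast)

theorem inverse_mem_weakFlag (h : Carries φ Δ Δ') (k : ℕ) (x : M) (hx : x ∈ φ.source)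
    (v : TangentSpace 𝓘(ℝ, E') (φ x)) (hv : v ∈ weakFlag Δ' k (φ x)) :
    (mfderiv 𝓘(ℝ, E) 𝓘(ℝ, E') φ x).inverse v ∈ weakFlag Δ k x := by
  induction k using Nat.twoStepInduction generalizing x with
  | zero =>
    obtain rfl : v = 0 := hv
    rw [map_zero]
    exact zero_mem _
  | one => exact h.inverse_mem hx hv
  | more i _ ih =>
    suffices weakFlag Δ' (i + 2) (φ x) ≤
        (weakFlag Δ (i + 2) x).comap (mfderiv 𝓘(ℝ, E) 𝓘(ℝ, E') φ x).inverse.toLinearMap from this hv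
    refine weakFlag_add_two_le
      (fun w hw => weakFlag_monotone Δ x (Nat.le_succ (i + 1)) (ih x hx w hw)) fun X Y hX hY => ?_
    exact (congrArg (· ∈ weakFlag Δ (i + 2) x) (h.mpullback_mlieBracket hx hX hY)).mpr
      (mlieBracket_mem_weakFlag
        (h.isLocalSection_mpullback (fun _ hy _ => h.inverse_mem hy) hx hX)
        (h.isLocalSection_mpullback ih hx hY))

protected theorem weakFlag [CompleteSpace E'] (h : Carries φ Δ Δ') (k : ℕ) :
    Carries φ (weakFlag Δ k) (weakFlag Δ' k) where
  smooth := h.smooth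
  smooth_symm := h.smooth_symm
  map_eq x hx := by
    ext v
    constructor
    · intro hv
      exact ⟨_, h.inverse_mem_weakFlag k x hx v hv,
        ((h.isInvertible hx).inverse_apply_eq.1 rfl).symm⟩
    · rintro ⟨w, hw, rfl⟩
      have comp_eq := h.mdifferentiable.symm_comp_deriv hx
      have inverse_mem := h.symm.inverse_mem_weakFlag k (φ x) (φ.map_source hx)
      have invertible := h.symm.isInvertible (φ.map_source hx)
      rw [φ.left_inv hx] at inverse_mem
      refine (congrArg (· ∈ weakFlag Δ' k (φ x)) (invertible.inverse_apply_eq.2 ?_)).mp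
        (inverse_mem w hw)
      exact (DFunLike.congr_fun comp_eq w).symm

end Carries

end LocalEquivalence

section IntegrableExtension

variable {E : Type*} [NormedAddCommGroup E] [NormedSpace ℝ E]
  {M : Type*} [TopologicalSpace M] [ChartedSpace E M]
  {E' : Type*} [NormedAddCommGroup E'] [NormedSpace ℝ E']
  {M' : Type*} [TopologicalSpace M'] [ChartedSpace E' M']
  {E'' : Type*} [NormedAddCommGroup E''] [NormedSpace ℝ E'']
  {M'' : Type*} [TopologicalSpace M''] [ChartedSpace E'' M'']
  {Δ : ∀ x : M, Submodule ℝ (TangentSpace 𝓘(ℝ, E) x)}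
  {Δ' : ∀ x : M', Submodule ℝ (TangentSpace 𝓘(ℝ, E') x)}
  {Δ'' : ∀ x : M'', Submodule ℝ (TangentSpace 𝓘(ℝ, E'') x)}
  {π : M' → M} {Φ : M ≃ₜ M''}

theorem Carries.bijective_mfderiv (hΦ : Carries Φ.toOpenPartialHomeomorph Δ Δ'') (x : M) :
    Function.Bijective (mfderiv 𝓘(ℝ, E) 𝓘(ℝ, E'') Φ x) :=
  hΦ.mdifferentiable.mfderiv_bijective (Set.mem_univ x)

theorem Carries.mfderiv_comp_apply (hΦ : Carries Φ.toOpenPartialHomeomorph Δ Δ'') {x : M'}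
    (hπ : MDifferentiableAt 𝓘(ℝ, E') 𝓘(ℝ, E) π x) (v : TangentSpace 𝓘(ℝ, E') x) :
    mfderiv 𝓘(ℝ, E') 𝓘(ℝ, E'') (Φ ∘ π) x v =
      mfderiv 𝓘(ℝ, E) 𝓘(ℝ, E'') Φ (π x) (mfderiv 𝓘(ℝ, E') 𝓘(ℝ, E) π x v) :=
  _root_.mfderiv_comp_apply x (hΦ.mdifferentiable.mdifferentiableAt (Set.mem_univ _)) hπ v

theorem Carries.ker_mfderiv_comp (hΦ : Carries Φ.toOpenPartialHomeomorph Δ Δ'') {x : M'}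
    (hπ : MDifferentiableAt 𝓘(ℝ, E') 𝓘(ℝ, E) π x) :
    (mfderiv 𝓘(ℝ, E') 𝓘(ℝ, E'') (Φ ∘ π) x).toLinearMap.ker =
      (mfderiv 𝓘(ℝ, E') 𝓘(ℝ, E) π x).toLinearMap.ker := by
  ext v
  refine Iff.trans ?_ (map_eq_zero_iff _ (hΦ.bijective_mfderiv (π x)).injective)
  exact (congrArg (· = 0) (hΦ.mfderiv_comp_apply hπ v)).to_iff

theorem Carries.bijOn_mfderiv (hΦ : Carries Φ.toOpenPartialHomeomorph Δ Δ'') (x : M) :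
    Set.BijOn (mfderiv 𝓘(ℝ, E) 𝓘(ℝ, E'') Φ x) (Δ x) (Δ'' (Φ x)) := by
  have h := hΦ.map_eq x (Set.mem_univ x)
  exact (congrArg (fun D : Submodule ℝ (TangentSpace 𝓘(ℝ, E'') (Φ x)) =>
    Set.BijOn (mfderiv 𝓘(ℝ, E) 𝓘(ℝ, E'') Φ x) (Δ x) D) h).mpr
    (hΦ.bijective_mfderiv x).injective.injOn.bijOn_image

variable [IsManifold 𝓘(ℝ, E') ∞ M']

theorem IsIntegrableExtension.mdifferentiableAt (hπ : IsIntegrableExtension π Δ' Δ) (x : M') :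
    MDifferentiableAt 𝓘(ℝ, E') 𝓘(ℝ, E) π x :=
  hπ.smooth.mdifferentiableAt (by simp)

theorem IsIntegrableExtension.carries_comp (hπ : IsIntegrableExtension π Δ' Δ)
    (hΦ : Carries Φ.toOpenPartialHomeomorph Δ Δ'') : IsIntegrableExtension (Φ ∘ π) Δ' Δ'' where
  smooth := (contMDiffOn_univ.1 hΦ.smooth).comp hπ.smooth
  surjective := Φ.surjective.comp hπ.surjective
  submersion x := by
    rw [funext (hΦ.mfderiv_comp_apply (hπ.mdifferentiableAt x))]
    exact (hΦ.bijective_mfderiv (π x)).surjective.comp (hπ.submersion x)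
  bijOn x :=
    ((hΦ.bijOn_mfderiv (π x)).comp (hπ.bijOn x)).congr fun v _ =>
      (hΦ.mfderiv_comp_apply (hπ.mdifferentiableAt x) v).symm
  horizontal x := hΦ.ker_mfderiv_comp (hπ.mdifferentiableAt x) ▸ hπ.horizontal x

theorem HasPureGrading.carries_comp {k : ℕ} (hk : HasPureGrading (E := E) π Δ' k)
    (hπ : IsIntegrableExtension π Δ' Δ) (hΦ : Carries Φ.toOpenPartialHomeomorph Δ Δ'') :
    HasPureGrading (E := E'') (Φ ∘ π) Δ' k :=
  fun x => hΦ.ker_mfderiv_comp (hπ.mdifferentiableAt x) ▸ hk x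

end IntegrableExtension

section GradedQuotient

theorem iSupIndep_map_of_ker_eq {V W : Type*} [AddCommGroup V] [Module ℝ V] [AddCommGroup W]
    [Module ℝ W] {ι : Type*} {g : ι → Submodule ℝ V} (hg : iSupIndep g) {f : V →ₗ[ℝ] W} {μ : ι}
    (hker : f.ker = g μ) : iSupIndep fun i => (g i).map f := by
  intro i
  simp only [← Submodule.map_iSup]
  rcases eq_or_ne μ i with rfl | hμ
  · rw [← hker, (Submodule.map_le_iff_le_comap.2 le_rfl : f.ker.map f ≤ ⊥).antisymm bot_le]
    exact disjoint_bot_left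
  rw [Submodule.disjoint_def]
  rintro _ ⟨a, ha, rfl⟩ hb
  have preimage := Submodule.comap_map_eq f (⨆ j, ⨆ (_ : j ≠ i), g j)
  rw [hker, sup_eq_left.2 (le_iSup₂_of_le μ hμ le_rfl)] at preimage
  rw [Submodule.disjoint_def.1 (hg i) a ha (preimage.le hb), map_zero]

variable {L' : Type*} [LieRing L'] [LieAlgebra ℝ L'] {g' : ℕ → Submodule ℝ L'}
  {L : Type*} [LieRing L] [LieAlgebra ℝ L] {g : ℕ → Submodule ℝ L}

/-- The component of lowest degree as an ideal. -/
def IsFundamentalGNLA.bottomIdeal (hg : IsFundamentalGNLA g) {μ : ℕ}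
    (hμ : ∀ i, μ < i → g i = ⊥) : LieIdeal ℝ L where
  __ := g μ
  lie_mem {x y} hy := by
    have h := hg.lie_mem_iSup_add x (n := μ) (Submodule.mem_iSup_of_mem 0 hy)
    have h_zero : ⁅x, y⁆ = 0 := by simpa [fun i => hμ (μ + 1 + i) (by omega)] using h
    rw [h_zero]
    exact (g μ).zero_mem

theorem IsFundamentalGNLA.map (hg : IsFundamentalGNLA g) {f : L →ₗ⁅ℝ⁆ L'}
    (hf : Function.Surjective f) {μ : ℕ} (hker : f.toLinearMap.ker = g μ) :
    IsFundamentalGNLA fun i => (g i).map f.toLinearMap where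
  finite := by
    have := hg.finite
    exact Module.Finite.of_surjective f.toLinearMap hf
  zero := by rw [hg.zero, Submodule.map_bot]
  internal := DirectSum.isInternal_submodule_of_iSupIndep_of_iSup_eq_top
    (iSupIndep_map_of_ker_eq hg.iSupIndep hker) (by
      rw [← Submodule.map_iSup, hg.iSup_eq_top, Submodule.map_top]
      exact LinearMap.range_eq_top.2 hf)
  lie_mem := by
    rintro i j _ _ ⟨x, hx, rfl⟩ ⟨y, hy, rfl⟩
    exact ⟨⁅x, y⁆, hg.lie_mem i j x y hx hy, f.map_lie x y⟩
  generates := by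
    have h : LieSubalgebra.lieSpan ℝ L (g 1 : Set L) ≤
        (LieSubalgebra.lieSpan ℝ L' ((g 1).map f.toLinearMap : Set L')).comap f :=
      LieSubalgebra.lieSpan_le.2 fun x hx => LieSubalgebra.subset_lieSpan ⟨x, hx, rfl⟩
    rw [hg.generates] at h
    exact eq_top_iff.2 (hf.forall.2 fun x _ => h (LieSubalgebra.mem_top x))

theorem map_ad_pow_apply (f : L →ₗ⁅ℝ⁆ L') (x v : L) (k : ℕ) :
    f ((LieAlgebra.ad ℝ L x ^ k) v) = (LieAlgebra.ad ℝ L' (f x) ^ k) (f v) := by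
  induction k with
  | zero => rfl
  | succ k ih => simp only [pow_succ', Module.End.mul_apply, LieAlgebra.ad_apply, f.map_lie, ih]

theorem map_maurerCartan [FiniteDimensional ℝ L] (hg' : IsFundamentalGNLA g') {f : L →ₗ⁅ℝ⁆ L'}
    (hf : Function.Surjective f) (x v : L) : f (maurerCartan x v) = maurerCartan (f x) (f v) := by
  simp only [maurerCartan, LinearMap.coe_sum, Finset.sum_apply, LinearMap.smul_apply, map_sum,
    map_smul, map_ad_pow_apply]
  refine (Finset.sum_subset (Finset.range_mono
    (LinearMap.finrank_le_finrank_of_surjective (f := f.toLinearMap) hf)) fun k _ hk => ?_).symm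
  rw [pow_eq_zero_of_le (by simpa using hk) (hg'.ad_pow_finrank (f x)), LinearMap.zero_apply,
    smul_zero]

variable {E' : Type*} [NormedAddCommGroup E'] [NormedSpace ℝ E']
  {E : Type*} [NormedAddCommGroup E] [NormedSpace ℝ E] [FiniteDimensional ℝ E]

/-- The homomorphism `f` in the linear coordinates `e` and `e'`, which are exponential coordinates
on the groups. -/
noncomputable def coordHom (f : L →ₗ⁅ℝ⁆ L') (e : E ≃ₗ[ℝ] L) (e' : E' ≃ₗ[ℝ] L') : E →L[ℝ] E' :=
  (e'.symm.toLinearMap ∘ₗ f.toLinearMap ∘ₗ e.toLinearMap).toContinuousLinearMap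

theorem apply_coordHom (f : L →ₗ⁅ℝ⁆ L') (e : E ≃ₗ[ℝ] L) (e' : E' ≃ₗ[ℝ] L') (x : E) :
    e' (coordHom f e e' x) = f (e x) :=
  e'.apply_symm_apply _

theorem mfderiv_coordHom (f : L →ₗ⁅ℝ⁆ L') (e : E ≃ₗ[ℝ] L) (e' : E' ≃ₗ[ℝ] L') (x : E) :
    mfderiv 𝓘(ℝ, E) 𝓘(ℝ, E') (coordHom f e e') x = coordHom f e e' :=
  mfderiv_eq_fderiv.trans (coordHom f e e').fderiv

variable {f : L →ₗ⁅ℝ⁆ L'} (e : E ≃ₗ[ℝ] L) (e' : E' ≃ₗ[ℝ] L')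

theorem surjective_coordHom (hf : Function.Surjective f) :
    Function.Surjective (coordHom f e e') :=
  e'.symm.surjective.comp (hf.comp e.surjective)

variable [FiniteDimensional ℝ E']

theorem coframe_coordHom (hg : IsFundamentalGNLA g) (hg' : IsFundamentalGNLA g')
    (hf : Function.Surjective f) (x v : E) :
    coframe hg' e' (coordHom f e e' x) (coordHom f e e' v) = f (coframe hg e x v) := by
  have := hg.finite
  rw [coframe_apply, coframe_apply, coordForm_apply, coordForm_apply, apply_coordHom,
    apply_coordHom, map_maurerCartan hg' hf]

theorem ker_mfderiv_coordHom (hg : IsFundamentalGNLA g) (hg' : IsFundamentalGNLA g')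
    (hf : Function.Surjective f) (x : E) :
    (mfderiv 𝓘(ℝ, E) 𝓘(ℝ, E') (coordHom f e e') x).toLinearMap.ker =
      leftInvariantDistribution hg e f.toLinearMap.ker x := by
  rw [mfderiv_coordHom]
  ext v
  exact ((coframe hg' e' (coordHom f e e' x)).map_eq_zero_iff.symm.trans
    (congrArg (· = 0) (coframe_coordHom e e' hg hg' hf x v)).to_iff)

theorem leftInvariantDistribution_coordHom (hg : IsFundamentalGNLA g)
    (hg' : IsFundamentalGNLA g') (hf : Function.Surjective f) (S : Submodule ℝ L) (x : E) :
    leftInvariantDistribution hg' e' (S.map f.toLinearMap) (coordHom f e e' x) =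
      (leftInvariantDistribution hg e S x).map
        (mfderiv 𝓘(ℝ, E) 𝓘(ℝ, E') (coordHom f e e') x).toLinearMap := by
  rw [mfderiv_coordHom]
  ext w
  constructor
  · rintro ⟨a, ha, h⟩
    have hv := coframe_leftInvariantField hg e a x
    refine ⟨(leftInvariantField hg e a x : E), (congrArg (· ∈ S) hv).mpr ha,
      (coframe hg' e' (coordHom f e e' x)).injective ?_⟩
    exact (coframe_coordHom e e' hg hg' hf x _).trans ((congrArg f hv).trans h)
  · rintro ⟨v : E, hv, rfl⟩
    exact ⟨_, hv, (coframe_coordHom e e' hg hg' hf x v).symm⟩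

theorem weakFlag_inf_ker_mfderiv_coordHom (hg : IsFundamentalGNLA g)
    (hg' : IsFundamentalGNLA g') (hf : Function.Surjective f) {μ k : ℕ}
    (hker : f.toLinearMap.ker = g μ) (hk : k < μ) (x : E) :
    weakFlag (standardDistribution g e) k x ⊓
      (mfderiv 𝓘(ℝ, E) 𝓘(ℝ, E') (coordHom f e e') x).toLinearMap.ker = ⊥ := by
  rw [weakFlag_standardDistribution hg, ker_mfderiv_coordHom e e' hg hg' hf, hker]
  exact (Submodule.comap_inf _ _ _).symm.trans
    ((hg.disjoint_partialSups hk).eq_bot ▸ congrFun (leftInvariantDistribution_bot hg e) x)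

theorem isIntegrableExtension_coordHom (hg : IsFundamentalGNLA g) (hf : Function.Surjective f)
    {μ : ℕ} (hμ : 2 < μ) (hker : f.toLinearMap.ker = g μ) :
    IsIntegrableExtension (coordHom f e e') (standardDistribution g e)
      (standardDistribution (fun i => (g i).map f.toLinearMap) e') where
  smooth := (coordHom f e e').contDiff.contMDiff
  surjective := surjective_coordHom e e' hf
  submersion x := by
    rw [mfderiv_coordHom]
    exact surjective_coordHom e e' hf
  bijOn x := by
    have hg' := hg.map hf hker
    rw [standardDistribution_eq hg', leftInvariantDistribution_coordHom e e' hg hg' hf,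
      ← standardDistribution_eq hg]
    exact (LinearMap.injOn_of_disjoint_ker le_rfl (disjoint_iff.2
      (weakFlag_inf_ker_mfderiv_coordHom e e' hg hg' hf hker (by omega : 1 < μ) x))).bijOn_image
  horizontal x := weakFlag_inf_ker_mfderiv_coordHom e e' hg (hg.map hf hker) hf hker hμ x

theorem hasPureGrading_coordHom (hg : IsFundamentalGNLA g) (hf : Function.Surjective f)
    {μ : ℕ} (hμ : μ ≠ 0) (hker : f.toLinearMap.ker = g μ) :
    HasPureGrading (E := E') (coordHom f e e') (standardDistribution g e) μ := by
  have hg' := hg.map hf hker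
  refine fun x => ⟨?_, weakFlag_inf_ker_mfderiv_coordHom e e' hg hg' hf hker (by omega) x⟩
  rw [weakFlag_standardDistribution hg, ker_mfderiv_coordHom e e' hg hg' hf, hker]
  exact leftInvariantDistribution_mono hg e (le_partialSups g μ) x

end GradedQuotient

section VectorSpaceHomeomorph

variable {E : Type*} [NormedAddCommGroup E] [NormedSpace ℝ E]
  {E' : Type*} [NormedAddCommGroup E'] [NormedSpace ℝ E']

theorem carries_of_homeomorph (Φ : E ≃ₜ E') (hΦ : ContDiff ℝ ∞ Φ) (hΦ' : ContDiff ℝ ∞ Φ.symm)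
    {Δ : ∀ x : E, Submodule ℝ (TangentSpace 𝓘(ℝ, E) x)}
    {Δ' : ∀ x : E', Submodule ℝ (TangentSpace 𝓘(ℝ, E') x)}
    (h : ∀ x v : E, fderiv ℝ Φ x v ∈ Δ' (Φ x) ↔ v ∈ Δ x) :
    Carries (E := E) (E' := E') Φ.toOpenPartialHomeomorph Δ Δ' where
  smooth := hΦ.contMDiff.contMDiffOn
  smooth_symm := hΦ'.contMDiff.contMDiffOn
  map_eq x _ := by
    have hmem (v : E) : mfderiv 𝓘(ℝ, E) 𝓘(ℝ, E') Φ x v ∈ Δ' (Φ x) ↔ v ∈ Δ x :=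
      (congrArg (fun T : E →L[ℝ] E' => T v ∈ Δ' (Φ x)) mfderiv_eq_fderiv).to_iff.trans (h x v)
    have hd : Φ.toOpenPartialHomeomorph.MDifferentiable 𝓘(ℝ, E) 𝓘(ℝ, E') :=
      ⟨(hΦ.differentiable (by simp)).mdifferentiable.mdifferentiableOn,
        (hΦ'.differentiable (by simp)).mdifferentiable.mdifferentiableOn⟩
    refine le_antisymm ?_ (Submodule.map_le_iff_le_comap.2 fun v hv => (hmem v).2 hv)
    rintro w hw
    obtain ⟨v, rfl⟩ := hd.mfderiv_surjective (Set.mem_univ x) w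
    exact Submodule.mem_map_of_mem ((hmem v).1 hw)

theorem Carries.refl (Δ : ∀ x : E, Submodule ℝ (TangentSpace 𝓘(ℝ, E) x)) :
    Carries (E := E) (E' := E) (Homeomorph.refl E).toOpenPartialHomeomorph Δ Δ :=
  carries_of_homeomorph _ contDiff_id contDiff_id fun x v =>
    (congrArg (fun T : E →L[ℝ] E => T v ∈ Δ x) fderiv_id).to_iff

end VectorSpaceHomeomorph

section HilbertCartan

theorem hilbertCartan_eq_span (p : EuclideanSpace ℝ (Fin 5)) :
    (hilbertCartan p : Submodule ℝ (EuclideanSpace ℝ (Fin 5))) =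
      Submodule.span ℝ {!₂[1, p 4 ^ 2, p 3, p 4, 0], !₂[0, 0, 0, 0, 1]} := by
  have hX : (totalDerivative (N := 3)
      (fun p i => if i.val + 1 = 1 then p 4 ^ 2 else p i.succ.succ) p :
        EuclideanSpace ℝ (Fin 5)) = !₂[1, p 4 ^ 2, p 3, p 4, 0] := by
    ext i
    fin_cases i <;> rfl
  have hV : (lastVector 3 : EuclideanSpace ℝ (Fin 5)) = !₂[0, 0, 0, 0, 1] := by
    ext i
    fin_cases i <;> simp [lastVector, Fin.last]
  rw [← hX, ← hV]
  rfl

theorem mem_hilbertCartan (p w : EuclideanSpace ℝ (Fin 5)) :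
    w ∈ (hilbertCartan p : Submodule ℝ (EuclideanSpace ℝ (Fin 5))) ↔
      w 1 = p 4 ^ 2 * w 0 ∧ w 2 = p 3 * w 0 ∧ w 3 = p 4 * w 0 := by
  have h_span : w ∈ (hilbertCartan p : Submodule ℝ (EuclideanSpace ℝ (Fin 5))) ↔
      ∃ a b : ℝ, a • !₂[1, p 4 ^ 2, p 3, p 4, 0] + b • !₂[0, 0, 0, 0, 1] = w :=
    (congrArg (fun S : Submodule ℝ (EuclideanSpace ℝ (Fin 5)) => w ∈ S)
      (hilbertCartan_eq_span p)).to_iff.trans Submodule.mem_span_pair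
  refine h_span.trans ⟨?_, fun ⟨hy, hz, hz₁⟩ => ⟨w 0, w 4, ?_⟩⟩
  · rintro ⟨a, b, rfl⟩
    simp [mul_comm]
  · ext i
    fin_cases i <;> simp [hy, hz, hz₁, mul_comm]

theorem contDiff_euclidean_five {E : Type*} [NormedAddCommGroup E] [NormedSpace ℝ E]
    {a b c d e : E → ℝ} (ha : ContDiff ℝ ∞ a) (hb : ContDiff ℝ ∞ b) (hc : ContDiff ℝ ∞ c)
    (hd : ContDiff ℝ ∞ d) (he : ContDiff ℝ ∞ e) :
    ContDiff ℝ ∞ fun x => !₂[a x, b x, c x, d x, e x] := by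
  refine contDiff_euclidean.2 fun i => ?_
  fin_cases i <;> assumption

/-- The jet coordinates of the Hilbert-Cartan equation in terms of the exponential coordinates of
the free nilpotent Lie group of type `(2, 1, 2)`. -/
noncomputable def hilbertCartanJet (x : EuclideanSpace ℝ (Fin 5)) : EuclideanSpace ℝ (Fin 5) :=
  !₂[x 0, x 0 * x 1 ^ 2 / 3 - x 1 * x 2 - 2 * x 4, x 0 ^ 2 * x 1 / 6 - x 0 * x 2 / 2 + x 3,
    x 0 * x 1 / 2 - x 2, x 1]

/-- The inverse of `hilbertCartanJet`. -/
noncomputable def hilbertCartanExp (p : EuclideanSpace ℝ (Fin 5)) : EuclideanSpace ℝ (Fin 5) :=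
  !₂[p 0, p 4, p 0 * p 4 / 2 - p 3, p 2 + p 0 ^ 2 * p 4 / 12 - p 0 * p 3 / 2,
    (p 3 * p 4 - p 0 * p 4 ^ 2 / 6 - p 1) / 2]

theorem contDiff_hilbertCartanJet : ContDiff ℝ ∞ hilbertCartanJet := by
  apply contDiff_euclidean_five <;> fun_prop

theorem contDiff_hilbertCartanExp : ContDiff ℝ ∞ hilbertCartanExp := by
  apply contDiff_euclidean_five <;> fun_prop

/-- The change from exponential coordinates on the free nilpotent Lie group of type `(2, 1, 2)` to
the jet coordinates of the Hilbert-Cartan equation. -/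
noncomputable def hilbertCartanChart : EuclideanSpace ℝ (Fin 5) ≃ₜ EuclideanSpace ℝ (Fin 5) where
  toFun := hilbertCartanJet
  invFun := hilbertCartanExp
  left_inv x := by
    ext i
    fin_cases i <;> simp [hilbertCartanJet, hilbertCartanExp] <;> ring
  right_inv p := by
    ext i
    fin_cases i <;> simp [hilbertCartanJet, hilbertCartanExp] <;> ring
  continuous_toFun := contDiff_hilbertCartanJet.continuous
  continuous_invFun := contDiff_hilbertCartanExp.continuous

theorem fderiv_hilbertCartanJet (x v : EuclideanSpace ℝ (Fin 5)) :
    fderiv ℝ hilbertCartanJet x v = !₂[v 0,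
      (v 0 * x 1 ^ 2 + 2 * x 0 * x 1 * v 1) / 3 - (v 1 * x 2 + x 1 * v 2) - 2 * v 4,
      (2 * x 0 * v 0 * x 1 + x 0 ^ 2 * v 1) / 6 - (v 0 * x 2 + x 0 * v 2) / 2 + v 3,
      (v 0 * x 1 + x 0 * v 1) / 2 - v 2, v 1] := by
  have hd := contDiff_hilbertCartanJet.differentiable (by simp) x
  have h_coord (i : Fin 5) : fderiv ℝ (fun y : EuclideanSpace ℝ (Fin 5) => y i) x v = v i :=
    DFunLike.congr_fun (EuclideanSpace.proj (𝕜 := ℝ) i).fderiv v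
  ext i
  have h_comp : fderiv ℝ hilbertCartanJet x v i =
      fderiv ℝ (fun y => hilbertCartanJet y i) x v :=
    (DFunLike.congr_fun ((EuclideanSpace.proj (𝕜 := ℝ) i).hasFDerivAt.comp x hd.hasFDerivAt).fderiv
      v).symm
  rw [h_comp]
  fin_cases i <;>
    simp (disch := fun_prop) [hilbertCartanJet, fderiv_fun_sub, fderiv_fun_add, fderiv_fun_mul,
      fderiv_fun_pow, div_eq_mul_inv, h_coord] <;> ring

end HilbertCartan

section FreeNilpotent

variable {L : Type*} [LieRing L] [LieAlgebra ℝ L] {g : ℕ → Submodule ℝ L}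

/-- The components of degree `-1`, `-2`, `-3` have dimensions `2`, `1`, `2`. For the grading of a
standard model this is the growth condition `(2, 1, 2, …)`. -/
structure HasTwoOneTwoGrading (g : ℕ → Submodule ℝ L) : Prop where
  finrank_one : Module.finrank ℝ (g 1) = 2
  finrank_two : Module.finrank ℝ (g 2) = 1
  finrank_three : Module.finrank ℝ (g 3) = 2

theorem HasTwoOneTwoGrading.finrank_eq_five (h : HasTwoOneTwoGrading g)
    (hg : IsFundamentalGNLA g) (hμ : ∀ i, 3 < i → g i = ⊥) : Module.finrank ℝ L = 5 := by
  rw [← finrank_top, ← hg.partialSups_eq_top hμ, hg.finrank_partialSups_add_one 2,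
    hg.finrank_partialSups_add_one 1, hg.partialSups_one, h.finrank_one, h.finrank_two,
    h.finrank_three]

theorem exists_eq_span_pair {S : Submodule ℝ L} (h : Module.finrank ℝ S = 2) :
    ∃ a b : L, S = Submodule.span ℝ {a, b} := by
  have : FiniteDimensional ℝ S := Module.finite_of_finrank_eq_succ h
  let B := Module.finBasisOfFinrankEq ℝ S h
  refine ⟨B 0, B 1, ?_⟩
  have hspan := congrArg (Submodule.map S.subtype) B.span_eq
  rw [Submodule.map_span, ← Set.range_comp, Submodule.map_subtype_top] at hspan
  refine hspan.symm.trans (congrArg _ ?_)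
  ext x
  simp [Fin.exists_fin_two, eq_comm]

/-- The Hall basis of the free nilpotent Lie algebra of step `3` on two generators `a` and `b`. -/
def hallFrame (a b : L) : Fin 5 → L :=
  ![a, b, ⁅a, b⁆, ⁅a, ⁅a, b⁆⁆, ⁅b, ⁅a, b⁆⁆]

/-- The element `hallFrame a b i` is a bracket of `hallDegree i` generators. -/
def hallDegree : Fin 5 → ℕ :=
  ![1, 1, 2, 3, 3]

theorem bracketSpan_span_pair_self (a b : L) :
    bracketSpan (Submodule.span ℝ {a, b}) (Submodule.span ℝ {a, b}) =
      Submodule.span ℝ {⁅a, b⁆} := by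
  rw [bracketSpan, Submodule.map₂_span_span]
  refine le_antisymm (Submodule.span_le.2 ?_) (Submodule.span_mono ?_)
  · rintro _ ⟨x, rfl | rfl, y, rfl | rfl, rfl⟩
    · simp
    · exact Submodule.mem_span_singleton_self _
    · exact (Submodule.mem_span_singleton.2 ⟨-1, by simp⟩ : ⁅x, y⁆ ∈ Submodule.span ℝ {⁅y, x⁆})
    · simp
  · exact Set.singleton_subset_iff.2 ⟨a, by simp, b, by simp, rfl⟩

theorem bracketSpan_span_pair_singleton (a b c : L) :
    bracketSpan (Submodule.span ℝ {a, b}) (Submodule.span ℝ {c}) =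
      Submodule.span ℝ {⁅a, c⁆, ⁅b, c⁆} := by
  simp [bracketSpan, Submodule.map₂_span_span, Set.image2_singleton_right, Set.image_pair]

namespace IsFundamentalGNLA

theorem two_eq_span (hg : IsFundamentalGNLA g) {a b : L} (hab : g 1 = Submodule.span ℝ {a, b}) :
    g 2 = Submodule.span ℝ {⁅a, b⁆} := by
  rw [← hg.bracketSpan_eq 0, hab, bracketSpan_span_pair_self]

theorem three_eq_span (hg : IsFundamentalGNLA g) {a b : L}
    (hab : g 1 = Submodule.span ℝ {a, b}) :
    g 3 = Submodule.span ℝ {⁅a, ⁅a, b⁆⁆, ⁅b, ⁅a, b⁆⁆} := by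
  rw [← hg.bracketSpan_eq 1, hab, hg.two_eq_span hab, bracketSpan_span_pair_singleton]

theorem hasTwoOneTwoGrading (hg : IsFundamentalGNLA g) (h_one : Module.finrank ℝ (g 1) = 2)
    (h_two : 3 ≤ Module.finrank ℝ (partialSups g 2))
    (h_three : 5 ≤ Module.finrank ℝ (partialSups g 3)) : HasTwoOneTwoGrading g := by
  obtain ⟨a, b, hab⟩ := exists_eq_span_pair h_one
  have h_le_one : Module.finrank ℝ (g 2) ≤ 1 := by
    rw [hg.two_eq_span hab]
    exact (finrank_span_le_card _).trans (by simp)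
  have h_le_two : Module.finrank ℝ (g 3) ≤ 2 := by
    classical
    rw [hg.three_eq_span hab]
    exact (finrank_span_le_card _).trans (by simpa using Finset.card_le_two)
  have h_add_two : Module.finrank ℝ (partialSups g 2) = 2 + Module.finrank ℝ (g 2) := by
    rw [hg.finrank_partialSups_add_one 1, hg.partialSups_one, h_one]
  have h_add_three : Module.finrank ℝ (partialSups g 3) =
      Module.finrank ℝ (partialSups g 2) + Module.finrank ℝ (g 3) :=
    hg.finrank_partialSups_add_one 2
  exact ⟨h_one, by omega, by omega⟩

theorem span_hallFrame (hg : IsFundamentalGNLA g) (hμ : ∀ i, 3 < i → g i = ⊥) {a b : L}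
    (hab : g 1 = Submodule.span ℝ {a, b}) : ⊤ ≤ Submodule.span ℝ (Set.range (hallFrame a b)) := by
  have h_sup : partialSups g 3 = partialSups g 1 ⊔ g 2 ⊔ g 3 :=
    (partialSups_add_one g 2).trans (congrArg (· ⊔ g 3) (partialSups_add_one g 1))
  rw [← hg.partialSups_eq_top hμ, h_sup, hg.partialSups_one, hab,
    hg.two_eq_span hab, hg.three_eq_span hab, ← Submodule.span_union, ← Submodule.span_union]
  refine Submodule.span_mono ?_
  rintro _ (((rfl | rfl) | rfl) | rfl | rfl)
  exacts [⟨0, rfl⟩, ⟨1, rfl⟩, ⟨2, rfl⟩, ⟨3, rfl⟩, ⟨4, rfl⟩]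

theorem hallFrame_mem (hg : IsFundamentalGNLA g) {a b : L} (ha : a ∈ g 1) (hb : b ∈ g 1)
    (i : Fin 5) : hallFrame a b i ∈ g (hallDegree i) := by
  have hab : ⁅a, b⁆ ∈ g 2 := hg.lie_mem 1 1 _ _ ha hb
  fin_cases i
  exacts [ha, hb, hab, hg.lie_mem 1 2 _ _ ha hab, hg.lie_mem 1 2 _ _ hb hab]

theorem lie_hallFrame_eq_zero (hg : IsFundamentalGNLA g) (hμ : ∀ i, 3 < i → g i = ⊥) {a b : L}
    (ha : a ∈ g 1) (hb : b ∈ g 1) {i j : Fin 5} (h : 3 < hallDegree i + hallDegree j) :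
    ⁅hallFrame a b i, hallFrame a b j⁆ = 0 := by
  have hmem := hg.lie_mem _ _ _ _ (hg.hallFrame_mem ha hb i) (hg.hallFrame_mem ha hb j)
  rwa [hμ _ h] at hmem

end IsFundamentalGNLA

/-- The bracket of the free nilpotent Lie algebra of type `(2, 1, 2)` in the Hall basis. -/
noncomputable def freeBracket (x v : EuclideanSpace ℝ (Fin 5)) : EuclideanSpace ℝ (Fin 5) :=
  !₂[0, 0, x 0 * v 1 - x 1 * v 0, x 0 * v 2 - x 2 * v 0, x 1 * v 2 - x 2 * v 1]

theorem IsFundamentalGNLA.lie_sum_hallFrame (hg : IsFundamentalGNLA g)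
    (hμ : ∀ i, 3 < i → g i = ⊥) {a b : L} (ha : a ∈ g 1) (hb : b ∈ g 1)
    (x v : EuclideanSpace ℝ (Fin 5)) :
    ⁅∑ i, x i • hallFrame a b i, ∑ i, v i • hallFrame a b i⁆ =
      ∑ i, freeBracket x v i • hallFrame a b i := by
  have h01 : ⁅hallFrame a b 0, hallFrame a b 1⁆ = hallFrame a b 2 := rfl
  have h02 : ⁅hallFrame a b 0, hallFrame a b 2⁆ = hallFrame a b 3 := rfl
  have h12 : ⁅hallFrame a b 1, hallFrame a b 2⁆ = hallFrame a b 4 := rfl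
  have h10 : ⁅hallFrame a b 1, hallFrame a b 0⁆ = -hallFrame a b 2 := by rw [← h01, lie_skew]
  have h20 : ⁅hallFrame a b 2, hallFrame a b 0⁆ = -hallFrame a b 3 := by rw [← h02, lie_skew]
  have h21 : ⁅hallFrame a b 2, hallFrame a b 1⁆ = -hallFrame a b 4 := by rw [← h12, lie_skew]
  have h_zero {i j : Fin 5} := hg.lie_hallFrame_eq_zero hμ ha hb (i := i) (j := j)
  simp (disch := decide) only [Fin.sum_univ_five, add_lie, lie_add, smul_lie, lie_smul, lie_self,
    h01, h02, h12, h10, h20, h21, h_zero]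
  simp only [freeBracket, Matrix.cons_val]
  module

/-- Linear coordinates `e` identifying `L` and its generating component with the free nilpotent
Lie algebra of type `(2, 1, 2)`. -/
structure IsFreeCoordinates (g : ℕ → Submodule ℝ L) (e : EuclideanSpace ℝ (Fin 5) ≃ₗ[ℝ] L) :
    Prop where
  lie_apply : ∀ x v, ⁅e x, e v⁆ = e (freeBracket x v)
  mem_one : ∀ v, e v ∈ g 1 ↔ v 2 = 0 ∧ v 3 = 0 ∧ v 4 = 0

theorem HasTwoOneTwoGrading.exists_isFreeCoordinates (h : HasTwoOneTwoGrading g)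
    (hg : IsFundamentalGNLA g) (hμ : ∀ i, 3 < i → g i = ⊥) : ∃ e, IsFreeCoordinates g e := by
  obtain ⟨a, b, hab⟩ := exists_eq_span_pair h.finrank_one
  have ha : a ∈ g 1 := hab ▸ Submodule.subset_span (by simp)
  have hb : b ∈ g 1 := hab ▸ Submodule.subset_span (by simp)
  have := hg.finite
  let B : Module.Basis (Fin 5) ℝ L := basisOfTopLeSpanOfCardEqFinrank (hallFrame a b)
    (hg.span_hallFrame hμ hab) (by simp [h.finrank_eq_five hg hμ])
  let e := (WithLp.linearEquiv 2 ℝ (Fin 5 → ℝ)).trans B.equivFun.symm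
  have he (x : EuclideanSpace ℝ (Fin 5)) : e x = ∑ i, x i • hallFrame a b i :=
    (B.equivFun_symm_apply _).trans (by simp [B])
  refine ⟨e, fun x v => ?_, fun v => ?_⟩
  · rw [he, he, he, hg.lie_sum_hallFrame hμ ha hb]
  · rw [hab, Submodule.mem_span_pair]
    constructor
    · rintro ⟨c, d, hcd⟩
      have hv : v = !₂[c, d, 0, 0, 0] := e.injective (by
        rw [← hcd, he]
        simp [Fin.sum_univ_five, hallFrame])
      simp [hv]
    · rintro ⟨h2, h3, h4⟩
      exact ⟨v 0, v 1, by simp [he, Fin.sum_univ_five, hallFrame, h2, h3, h4]⟩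

theorem IsFreeCoordinates.maurerCartan_apply {e : EuclideanSpace ℝ (Fin 5) ≃ₗ[ℝ] L}
    (h : IsFreeCoordinates g e) (x v : EuclideanSpace ℝ (Fin 5)) :
    maurerCartan (e x) (e v) =
      e (v - (1 / 2 : ℝ) • freeBracket x v + (1 / 6 : ℝ) • freeBracket x (freeBracket x v)) := by
  have h_rank : Module.finrank ℝ L = 5 := by simp [← e.finrank_eq]
  have h_cube : freeBracket x (freeBracket x (freeBracket x v)) = 0 := by
    ext i
    fin_cases i <;> simp [freeBracket]
  simp only [maurerCartan, h_rank, Finset.sum_range_succ, Finset.sum_range_zero,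
    LinearMap.add_apply, LinearMap.smul_apply, pow_succ', pow_zero, Module.End.mul_apply,
    LieAlgebra.ad_apply, h.lie_apply, Module.End.one_apply, h_cube, map_zero, smul_zero, add_zero,
    zero_add, map_add, map_sub, map_smul]
  norm_num [Nat.factorial]
  module

theorem IsFreeCoordinates.carries_hilbertCartanChart {e : EuclideanSpace ℝ (Fin 5) ≃ₗ[ℝ] L}
    (h : IsFreeCoordinates g e) :
    Carries (E := EuclideanSpace ℝ (Fin 5)) (E' := EuclideanSpace ℝ (Fin 5))
      hilbertCartanChart.toOpenPartialHomeomorph (standardDistribution g e) hilbertCartan := by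
  refine carries_of_homeomorph hilbertCartanChart contDiff_hilbertCartanJet
    contDiff_hilbertCartanExp fun x v => ?_
  have h_std : v ∈ (standardDistribution g e x : Submodule ℝ (EuclideanSpace ℝ (Fin 5))) ↔
      maurerCartan (e x) (e v) ∈ g 1 := Iff.rfl
  refine (mem_hilbertCartan _ _).trans (Iff.trans ?_ h_std.symm)
  rw [h.maurerCartan_apply, h.mem_one]
  have h_jet : fderiv ℝ hilbertCartanChart x v = _ := fderiv_hilbertCartanJet x v
  rw [h_jet]
  suffices h_forms :
      ((v 0 * x 1 ^ 2 + 2 * x 0 * x 1 * v 1) / 3 - (v 1 * x 2 + x 1 * v 2) - 2 * v 4 =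
          x 1 ^ 2 * v 0 ∧
        (2 * x 0 * v 0 * x 1 + x 0 ^ 2 * v 1) / 6 - (v 0 * x 2 + x 0 * v 2) / 2 + v 3 =
          (x 0 * x 1 / 2 - x 2) * v 0 ∧
        (v 0 * x 1 + x 0 * v 1) / 2 - v 2 = x 1 * v 0) ↔
      (v 2 - 2⁻¹ * (x 0 * v 1 - x 1 * v 0) = 0 ∧
        v 3 - 2⁻¹ * (x 0 * v 2 - x 2 * v 0) + 6⁻¹ * (x 0 * (x 0 * v 1 - x 1 * v 0)) = 0 ∧
        v 4 - 2⁻¹ * (x 1 * v 2 - x 2 * v 1) + 6⁻¹ * (x 1 * (x 0 * v 1 - x 1 * v 0)) = 0) by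
    simpa [freeBracket, hilbertCartanChart, hilbertCartanJet]
  constructor
  · rintro ⟨hy, hz, hz₁⟩
    refine ⟨?_, ?_, ?_⟩
    · linear_combination -hz₁
    · linear_combination hz
    · linear_combination (-1 / 2) * hy + x 1 * hz₁
  · rintro ⟨h2, h3, h4⟩
    refine ⟨?_, ?_, ?_⟩
    · linear_combination (-2) * h4 - 2 * x 1 * h2
    · linear_combination h3
    · linear_combination -h2

theorem carries_standardDistribution {E E' : Type*} [NormedAddCommGroup E] [NormedSpace ℝ E]
    [NormedAddCommGroup E'] [NormedSpace ℝ E'] (A : E ≃L[ℝ] E') (e : E' ≃ₗ[ℝ] L) :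
    Carries (E := E) (E' := E') A.toHomeomorph.toOpenPartialHomeomorph
      (standardDistribution g (A.toLinearEquiv.trans e)) (standardDistribution g e) :=
  carries_of_homeomorph _ A.contDiff A.symm.contDiff fun x v =>
    (congrArg (fun T : E →L[ℝ] E' => T v ∈ standardDistribution g e (A x)) A.fderiv).to_iff

theorem HasTwoOneTwoGrading.exists_carries_hilbertCartan (h : HasTwoOneTwoGrading g)
    (hg : IsFundamentalGNLA g) (hμ : ∀ i, 3 < i → g i = ⊥)
    (e : EuclideanSpace ℝ (Fin 5) ≃ₗ[ℝ] L) :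
    ∃ Φ : EuclideanSpace ℝ (Fin 5) ≃ₜ EuclideanSpace ℝ (Fin 5),
      Carries (E := EuclideanSpace ℝ (Fin 5)) (E' := EuclideanSpace ℝ (Fin 5))
        Φ.toOpenPartialHomeomorph (standardDistribution g e) hilbertCartan := by
  obtain ⟨e₀, he₀⟩ := h.exists_isFreeCoordinates hg hμ
  let A := (e.trans e₀.symm).toContinuousLinearEquiv
  have hA : A.toLinearEquiv.trans e₀ = e := by
    ext x
    exact e₀.apply_symm_apply (e x)
  have hcarries := (carries_standardDistribution (g := g) A e₀).trans
    he₀.carries_hilbertCartanChart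
  rw [hA, ← Homeomorph.trans_toOpenPartialHomeomorph] at hcarries
  exact ⟨_, hcarries⟩

end FreeNilpotent

section Tower

section Quotient

variable {L : Type*} [LieRing L] [LieAlgebra ℝ L]

/-- The projection onto the quotient by an ideal, as a homomorphism of Lie algebras. -/
def quotientHom (J : LieIdeal ℝ L) : L →ₗ⁅ℝ⁆ L ⧸ J where
  __ := (LieSubmodule.Quotient.mk' J : L →ₗ[ℝ] L ⧸ J)
  map_lie' {x y} := LieSubmodule.Quotient.mk_bracket J x y

theorem surjective_quotientHom (J : LieIdeal ℝ L) : Function.Surjective (quotientHom J) :=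
  LieSubmodule.Quotient.surjective_mk' J

theorem ker_quotientHom (J : LieIdeal ℝ L) : (quotientHom J).toLinearMap.ker = J.toSubmodule :=
  Submodule.ext fun _ => LieSubmodule.Quotient.mk_eq_zero' (N := J)

variable {L' : Type*} [LieRing L'] [LieAlgebra ℝ L'] {g : ℕ → Submodule ℝ L} {f : L →ₗ⁅ℝ⁆ L'}
  {μ : ℕ}

theorem IsFundamentalGNLA.finrank_map (hg : IsFundamentalGNLA g) (hker : f.toLinearMap.ker = g μ)
    {i : ℕ} (hi : i ≠ μ) :
    Module.finrank ℝ ((g i).map f.toLinearMap) = Module.finrank ℝ (g i) := by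
  rw [← LinearMap.range_domRestrict]
  refine LinearMap.finrank_range_of_inj (LinearMap.injective_domRestrict_iff.2 ?_)
  rw [hker]
  exact (hg.iSupIndep.pairwiseDisjoint hi)

theorem HasTwoOneTwoGrading.map (h : HasTwoOneTwoGrading g) (hg : IsFundamentalGNLA g)
    (hμ : 3 < μ) (hker : f.toLinearMap.ker = g μ) :
    HasTwoOneTwoGrading fun i => (g i).map f.toLinearMap where
  finrank_one := (hg.finrank_map hker (by omega)).trans h.finrank_one
  finrank_two := (hg.finrank_map hker (by omega)).trans h.finrank_two
  finrank_three := (hg.finrank_map hker (by omega)).trans h.finrank_three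

theorem IsFundamentalGNLA.finrank_lt_of_ker_eq (hg : IsFundamentalGNLA g)
    (hf : Function.Surjective f) (hker : f.toLinearMap.ker = g μ) (hbot : g μ ≠ ⊥) :
    Module.finrank ℝ L' < Module.finrank ℝ L := by
  have := hg.finite
  have h_ker := Submodule.one_le_finrank_iff.2 hbot
  have h_rank := LinearMap.finrank_range_add_finrank_ker f.toLinearMap
  rw [LinearMap.range_eq_top.2 hf, finrank_top, hker] at h_rank
  omega

end Quotient

theorem isFlatOn_standardDistribution {E : Type*} [NormedAddCommGroup E] [NormedSpace ℝ E]
    {L : Type} [LieRing L] [LieAlgebra ℝ L] {g : ℕ → Submodule ℝ L} (hg : IsFundamentalGNLA g)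
    (e : E ≃ₗ[ℝ] L) (W : Set E) : IsFlatOn (standardDistribution g e) W :=
  ⟨L, _, _, g, e, hg, fun _ _ => locallyEquivalentAt_iff.2 ⟨_, Set.mem_univ _, .refl _⟩⟩

theorem IsSuccessiveExtension.step_standardDistribution {d d' : ℕ} {L L' : Type} [LieRing L]
    [LieAlgebra ℝ L] [LieRing L'] [LieAlgebra ℝ L'] {g : ℕ → Submodule ℝ L} {f : L →ₗ⁅ℝ⁆ L'}
    {μ : ℕ} {Δ : ∀ x : EuclideanSpace ℝ (Fin d),
      Submodule ℝ (TangentSpace 𝓘(ℝ, EuclideanSpace ℝ (Fin d)) x)}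
    {Φ : EuclideanSpace ℝ (Fin d) ≃ₜ EuclideanSpace ℝ (Fin d)} (hΔ : IsSuccessiveExtension d Δ)
    (hg : IsFundamentalGNLA g) (h_one : Module.finrank ℝ (g 1) = 2) (hf : Function.Surjective f)
    (hμ : 3 < μ) (hker : f.toLinearMap.ker = g μ) (hbot : g μ ≠ ⊥)
    (e : EuclideanSpace ℝ (Fin d') ≃ₗ[ℝ] L) (e' : EuclideanSpace ℝ (Fin d) ≃ₗ[ℝ] L')
    (hΦ : Carries (E := EuclideanSpace ℝ (Fin d)) (E' := EuclideanSpace ℝ (Fin d))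
      Φ.toOpenPartialHomeomorph
      (standardDistribution (fun i => (g i).map f.toLinearMap) e') Δ) :
    IsSuccessiveExtension d' (standardDistribution g e) := by
  have h_ext := isIntegrableExtension_coordHom e e' hg hf (by omega : 2 < μ) hker
  have h_pure := hasPureGrading_coordHom e e' hg hf (by omega : μ ≠ 0) hker
  have h_dim : d < d' := by
    have h_lt := hg.finrank_lt_of_ker_eq hf hker hbot
    rwa [← e.finrank_eq, ← e'.finrank_eq, finrank_euclideanSpace_fin,
      finrank_euclideanSpace_fin] at h_lt
  exact .step (Φ ∘ coordHom f e e') μ hΔ h_dim (h_one ▸ isDistribution_standardDistribution hg e)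
    (isFlatOn_standardDistribution hg e _) (h_ext.carries_comp hΦ)
    (completelyNonholonomic_standardDistribution hg e) hμ (h_pure.carries_comp h_ext hΦ)

theorem HasTwoOneTwoGrading.exists_isSuccessiveExtension (n : ℕ) {d : ℕ} {L : Type} [LieRing L]
    [LieAlgebra ℝ L] {g : ℕ → Submodule ℝ L} (h : HasTwoOneTwoGrading g)
    (hg : IsFundamentalGNLA g) (hn : ∀ i, n + 3 < i → g i = ⊥)
    (e : EuclideanSpace ℝ (Fin d) ≃ₗ[ℝ] L) :
    ∃ (Δ : ∀ x : EuclideanSpace ℝ (Fin d),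
        Submodule ℝ (TangentSpace 𝓘(ℝ, EuclideanSpace ℝ (Fin d)) x))
      (Φ : EuclideanSpace ℝ (Fin d) ≃ₜ EuclideanSpace ℝ (Fin d)),
      IsSuccessiveExtension d Δ ∧
        Carries (E := EuclideanSpace ℝ (Fin d)) (E' := EuclideanSpace ℝ (Fin d))
          Φ.toOpenPartialHomeomorph (standardDistribution g e) Δ := by
  induction n generalizing d L with
  | zero =>
    rw [zero_add] at hn
    obtain rfl : d = 5 := by
      rw [← finrank_euclideanSpace_fin (𝕜 := ℝ) (n := d), e.finrank_eq, h.finrank_eq_five hg hn]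
    obtain ⟨Φ, hΦ⟩ := h.exists_carries_hilbertCartan hg hn e
    exact ⟨hilbertCartan, Φ, .base, hΦ⟩
  | succ n ih =>
    by_cases hbot : g (n + 1 + 3) = ⊥
    · refine ih h hg (fun i hi => ?_) e
      rcases eq_or_ne i (n + 1 + 3) with rfl | hne
      exacts [hbot, hn i (by omega)]
    let f := quotientHom (hg.bottomIdeal hn)
    have hf : Function.Surjective f := surjective_quotientHom _
    have hker : f.toLinearMap.ker = g (n + 1 + 3) := ker_quotientHom _
    have hg' := hg.map hf hker
    have := hg'.finite
    have hn' (i : ℕ) (hi : n + 3 < i) : (g i).map f.toLinearMap = ⊥ := by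
      refine (Submodule.map_le_iff_le_comap.2 (hker ▸ ?_ : g i ≤ f.toLinearMap.ker)).antisymm bot_le
      rcases eq_or_ne i (n + 1 + 3) with rfl | hne
      exacts [le_rfl, (hn i (by omega)).trans_le bot_le]
    let e' : EuclideanSpace ℝ (Fin (Module.finrank ℝ (L ⧸ hg.bottomIdeal hn))) ≃ₗ[ℝ] _ :=
      LinearEquiv.ofFinrankEq _ (L ⧸ hg.bottomIdeal hn) finrank_euclideanSpace_fin
    obtain ⟨Δ, Φ, hΔ, hΦ⟩ := ih (h.map hg (by omega) hker) hg' hn' e'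
    have h_step :=
      hΔ.step_standardDistribution hg h.finrank_one hf (by omega) hker hbot e e' hΦ
    exact ⟨_, Homeomorph.refl _, h_step, .refl _⟩

theorem arisesFromHilbertCartanOn_of_isFlatOn {E : Type*} [NormedAddCommGroup E]
    [NormedSpace ℝ E] {M : Type*} [TopologicalSpace M] [ChartedSpace E M]
    [IsManifold 𝓘(ℝ, E) ∞ M] {Δ : ∀ x : M, Submodule ℝ (TangentSpace 𝓘(ℝ, E) x)} {W : Set M}
    (hflat : IsFlatOn Δ W)
    (hgrowth : ∀ p ∈ W, Module.finrank ℝ (weakFlag Δ 1 p) = 2 ∧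
      3 ≤ Module.finrank ℝ (weakFlag Δ 2 p) ∧ 5 ≤ Module.finrank ℝ (weakFlag Δ 3 p)) :
    ArisesFromHilbertCartanOn Δ W := by
  rcases W.eq_empty_or_nonempty with rfl | ⟨p, hp⟩
  · exact ⟨5, hilbertCartan, .base, fun p hp => hp.elim⟩
  obtain ⟨L, _, _, g, e, hg, hloc⟩ := hflat
  have := hg.finite
  have := e.symm.finiteDimensional
  have := FiniteDimensional.complete ℝ E
  have h_finrank (k : ℕ) :
      Module.finrank ℝ (weakFlag Δ k p) = Module.finrank ℝ (partialSups g k) := by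
    obtain ⟨φ, hpφ, hφ⟩ := locallyEquivalentAt_iff.1 (hloc p hp)
    rw [← (hφ.weakFlag k).finrank_eq hpφ, finrank_weakFlag_standardDistribution hg]
  have h_grading : HasTwoOneTwoGrading g := by
    obtain ⟨h_one, h_two, h_three⟩ := hgrowth p hp
    rw [h_finrank] at h_one h_two h_three
    exact hg.hasTwoOneTwoGrading (hg.partialSups_one ▸ h_one) h_two h_three
  obtain ⟨μ, hμ⟩ := hg.exists_forall_lt_eq_bot
  let A : E ≃L[ℝ] EuclideanSpace ℝ (Fin (Module.finrank ℝ E)) :=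
    (LinearEquiv.ofFinrankEq _ _ finrank_euclideanSpace_fin.symm).toContinuousLinearEquiv
  let e' := A.symm.toLinearEquiv.trans e
  have hA : A.toLinearEquiv.trans e' = e := by
    ext x
    exact congrArg e (A.symm_apply_apply x)
  obtain ⟨Δ', Φ, hΔ', hΦ⟩ := h_grading.exists_isSuccessiveExtension μ hg
    (fun i hi => hμ i (by omega)) e'
  refine ⟨_, Δ', hΔ', fun q hq => ?_⟩
  obtain ⟨φ, hqφ, hφ⟩ := locallyEquivalentAt_iff.1 (hloc q hq)
  rw [← hA] at hφ
  exact locallyEquivalentAt_iff.2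
    ⟨_, by simpa using hqφ, (hφ.trans (carries_standardDistribution A e')).trans hΦ⟩

end Tower

section BracketFrame

variable {E : Type*} [NormedAddCommGroup E] [NormedSpace ℝ E] {W : Set E} {X : E → E} {V p : E}

/-- The vector fields `X`, `V`, `[V, X]`, `[X, [V, X]]`, `[V, [V, X]]` for a constant vector field
`V`, so that bracketing with `V` is differentiation along `V`. -/
noncomputable def bracketFrame (X : E → E) (V p : E) : Fin 5 → E :=
  ![X p, V, fderiv ℝ X p V, VectorField.lieBracket ℝ X (fun q => fderiv ℝ X q V) p,
    fderiv ℝ (fun q => fderiv ℝ X q V) p V]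

section WeakFlag

variable {Δ : ∀ x : E, Submodule ℝ (TangentSpace 𝓘(ℝ, E) x)}

theorem isLocalSection_of_contDiffOn (hW : IsOpen W) (hX : ContDiffOn ℝ ∞ X W)
    (hXΔ : ∀ q ∈ W, X q ∈ Δ q) (hp : p ∈ W) : IsLocalSection Δ p X :=
  ⟨W, hW, hp, contMDiffOn_vectorSpace_iff_contDiffOn.2 hX, hXΔ⟩

theorem lieBracket_mem_weakFlag {k : ℕ} {Y : E → E} (hX : IsLocalSection Δ p X)
    (hY : IsLocalSection (weakFlag Δ (k + 1)) p Y) :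
    VectorField.lieBracket ℝ X Y p ∈ weakFlag Δ (k + 2) p :=
  (congrArg (· ∈ weakFlag Δ (k + 2) p) (mlieBracket_eq_lieBracket X Y p)).mp
    (mlieBracket_mem_weakFlag hX hY)

theorem fderiv_mem_weakFlag {k : ℕ} {Y : E → E} (hV : IsLocalSection Δ p fun _ => V)
    (hY : IsLocalSection (weakFlag Δ (k + 1)) p Y) : fderiv ℝ Y p V ∈ weakFlag Δ (k + 2) p := by
  have h_bracket : VectorField.lieBracket ℝ (fun _ => V) Y p = fderiv ℝ Y p V := by
    simp [VectorField.lieBracket]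
  exact h_bracket ▸ lieBracket_mem_weakFlag hV hY

theorem bracketFrame_mem_weakFlag (hW : IsOpen W) (hX : ContDiffOn ℝ ∞ X W)
    (hXΔ : ∀ q ∈ W, X q ∈ Δ q) (hVΔ : ∀ q ∈ W, V ∈ Δ q) (hp : p ∈ W) (i : Fin 5) :
    bracketFrame X V p i ∈ weakFlag Δ (hallDegree i) p := by
  have h_section (q : E) (hq : q ∈ W) := isLocalSection_of_contDiffOn hW hX hXΔ hq
  have h_const (q : E) (hq : q ∈ W) := isLocalSection_of_contDiffOn hW contDiffOn_const hVΔ hq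
  have h_deriv (q : E) (hq : q ∈ W) : fderiv ℝ X q V ∈ weakFlag Δ 2 q :=
    fderiv_mem_weakFlag (k := 0) (h_const q hq) (h_section q hq)
  have h_two : IsLocalSection (weakFlag Δ 2) p fun q => fderiv ℝ X q V :=
    isLocalSection_of_contDiffOn hW
      ((hX.fderiv_of_isOpen hW (by simp)).clm_apply contDiffOn_const) h_deriv hp
  fin_cases i
  exacts [hXΔ p hp, hVΔ p hp, h_deriv p hp, lieBracket_mem_weakFlag (k := 1) (h_section p hp) h_two,
    fderiv_mem_weakFlag (k := 1) (h_const p hp) h_two]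

theorem le_finrank_weakFlag [FiniteDimensional ℝ E]
    (h_mem : ∀ i, bracketFrame X V p i ∈ weakFlag Δ (hallDegree i) p)
    (h : LinearIndependent ℝ (bracketFrame X V p)) {r k : ℕ} (hr : r ≤ 5)
    (hk : ∀ i : Fin r, hallDegree (i.castLE hr) ≤ k) :
    r ≤ Module.finrank ℝ (weakFlag Δ k p) := by
  have h_prefix := h.comp _ (Fin.castLE_injective hr)
  let S : Submodule ℝ E := weakFlag Δ k p
  have h_span : Submodule.span ℝ (Set.range (bracketFrame X V p ∘ Fin.castLE hr)) ≤ S :=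
    Submodule.span_le.2 (Set.range_subset_iff.2 fun i => weakFlag_monotone Δ p (hk i) (h_mem _))
  have h_le := Submodule.finrank_mono h_span
  rwa [finrank_span_eq_card h_prefix, Fintype.card_fin] at h_le

end WeakFlag

theorem map_fderiv_of_eventuallyEq {F F' : Type*} [NormedAddCommGroup F] [NormedSpace ℝ F]
    [NormedAddCommGroup F'] [NormedSpace ℝ F'] (T : F →L[ℝ] F') {Y : E → F} {f : E → F'}
    (hY : DifferentiableAt ℝ Y p) (h : (fun q => T (Y q)) =ᶠ[𝓝 p] f) (v : E) :
    T (fderiv ℝ Y p v) = fderiv ℝ f p v := by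
  have h_comp : HasFDerivAt (fun q => T (Y q)) (T.comp (fderiv ℝ Y p)) p :=
    T.hasFDerivAt.comp p hY.hasFDerivAt
  rw [← h.fderiv_eq, h_comp.fderiv]
  rfl

theorem linearIndependent_of_isUpperTriangular {r : ℕ} (P : E →L[ℝ] Fin r → ℝ) (v : Fin r → E)
    (h_upper : ∀ i j, j < i → P (v i) j = 0) (h_diag : ∀ i, P (v i) i ≠ 0) :
    LinearIndependent ℝ v := by
  have h_det : (Matrix.of fun i => P (v i)).det ≠ 0 := by
    rw [Matrix.det_of_isUpperTriangular (M := Matrix.of fun i => P (v i)) h_upper]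
    exact Finset.prod_ne_zero_iff.2 fun i _ => h_diag i
  exact .of_comp P.toLinearMap (Matrix.linearIndependent_rows_of_det_ne_zero h_det)

variable {P : E →L[ℝ] Fin 5 → ℝ} {F : E → ℝ}

theorem jet_fderiv (hX : DifferentiableAt ℝ X p)
    (hPX : ∀ᶠ q in 𝓝 p, P (X q) = ![1, 0, P q 1, P q 2, F q]) (v : E) :
    P (fderiv ℝ X p v) = ![0, 0, P v 1, P v 2, fderiv ℝ F p v] := by
  have h_coord (i : Fin 5) : P (fderiv ℝ X p v) i =
      fderiv ℝ (fun q => (![1, 0, P q 1, P q 2, F q] : Fin 5 → ℝ) i) p v :=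
    map_fderiv_of_eventuallyEq ((ContinuousLinearMap.proj i).comp P) hX
      (hPX.mono fun q hq => congrFun hq i) v
  have h_linear (i : Fin 5) : fderiv ℝ (fun q => P q i) p v = P v i :=
    congrArg (· v) ((ContinuousLinearMap.proj i).comp P).fderiv
  ext i
  rw [h_coord]
  fin_cases i
  exacts [by simp, by simp, h_linear 1, h_linear 2, rfl]

theorem jet_fderiv_fderiv (hW : IsOpen W) (hX : ContDiffOn ℝ ∞ X W)
    (hPX : ∀ q ∈ W, P (X q) = ![1, 0, P q 1, P q 2, F q]) (hp : p ∈ W) (v : E) :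
    P (fderiv ℝ (fun q => fderiv ℝ X q V) p v) =
      ![0, 0, 0, 0, fderiv ℝ (fun q => fderiv ℝ F q V) p v] := by
  have h_first (q : E) (hq : q ∈ W) :
      P (fderiv ℝ X q V) = ![0, 0, P V 1, P V 2, fderiv ℝ F q V] :=
    jet_fderiv ((hX.contDiffAt (hW.mem_nhds hq)).differentiableAt (by simp))
      (Filter.eventually_of_mem (hW.mem_nhds hq) hPX) V
  have h_diff : DifferentiableAt ℝ (fun q => fderiv ℝ X q V) p :=
    (((hX.fderiv_of_isOpen hW (by simp)).clm_apply contDiffOn_const).contDiffAt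
      (hW.mem_nhds hp)).differentiableAt (n := ∞) (by simp)
  have h_coord (i : Fin 5) : P (fderiv ℝ (fun q => fderiv ℝ X q V) p v) i =
      fderiv ℝ (fun q => (![0, 0, P V 1, P V 2, fderiv ℝ F q V] : Fin 5 → ℝ) i) p v :=
    map_fderiv_of_eventuallyEq ((ContinuousLinearMap.proj i).comp P) h_diff
      (Filter.eventually_of_mem (hW.mem_nhds hp) fun q hq => congrFun (h_first q hq) i) v
  ext i
  rw [h_coord]
  fin_cases i <;> simp

theorem linearIndependent_bracketFrame (hW : IsOpen W) (hX : ContDiffOn ℝ ∞ X W)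
    (hPX : ∀ q ∈ W, P (X q) = ![1, 0, P q 1, P q 2, F q]) (hPV : P V = ![0, 1, 0, 0, 0])
    (hp : p ∈ W) (hF : fderiv ℝ (fun q => fderiv ℝ F q V) p V ≠ 0) :
    LinearIndependent ℝ (bracketFrame X V p) := by
  have h_first := jet_fderiv (P := P) ((hX.contDiffAt (hW.mem_nhds hp)).differentiableAt (by simp))
      (Filter.eventually_of_mem (hW.mem_nhds hp) hPX)
  have h_second := jet_fderiv_fderiv (V := V) hW hX hPX hp
  have h_bracket : P (VectorField.lieBracket ℝ X (fun q => fderiv ℝ X q V) p) =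
      ![0, 0, 0, -1, fderiv ℝ (fun q => fderiv ℝ F q V) p (X p) -
        fderiv ℝ F p (fderiv ℝ X p V)] := by
    rw [VectorField.lieBracket, map_sub, h_second, h_first, h_first, hPV]
    simp
  have h_frame (i : Fin 5) : P (bracketFrame X V p i) = ![P (X p), P V, P (fderiv ℝ X p V),
      P (VectorField.lieBracket ℝ X (fun q => fderiv ℝ X q V) p),
      P (fderiv ℝ (fun q => fderiv ℝ X q V) p V)] i := by
    fin_cases i <;> rfl
  simp only [hPX p hp, h_first, h_second, h_bracket, hPV] at h_frame
  refine linearIndependent_of_isUpperTriangular P _ (fun i j hij => ?_) fun i => ?_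
  · rw [h_frame]
    fin_cases i <;> fin_cases j <;> first | rfl | exact absurd hij (by decide)
  · rw [h_frame]
    fin_cases i
    exacts [one_ne_zero, one_ne_zero, one_ne_zero, neg_ne_zero.2 one_ne_zero, hF]

end BracketFrame

section Monge

variable {N : ℕ}

theorem totalDerivative_zero (G : EuclideanSpace ℝ (Fin (N + 2)) → Fin N → ℝ)
    (p : EuclideanSpace ℝ (Fin (N + 2))) : totalDerivative G p 0 = 1 := rfl

theorem totalDerivative_last (G : EuclideanSpace ℝ (Fin (N + 2)) → Fin N → ℝ)
    (p : EuclideanSpace ℝ (Fin (N + 2))) : totalDerivative G p (Fin.last (N + 1)) = 0 := by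
  rw [← Fin.succ_last]
  simp [totalDerivative]

theorem totalDerivative_castSucc_succ (G : EuclideanSpace ℝ (Fin (N + 2)) → Fin N → ℝ)
    (p : EuclideanSpace ℝ (Fin (N + 2))) (i : Fin N) :
    totalDerivative G p i.castSucc.succ = G p i := by
  simp [totalDerivative]

theorem contDiffOn_totalDerivative {G : EuclideanSpace ℝ (Fin (N + 2)) → Fin N → ℝ}
    {W : Set (EuclideanSpace ℝ (Fin (N + 2)))} (hG : ContDiffOn ℝ ∞ G W) :
    ContDiffOn ℝ ∞ (totalDerivative G) W := by
  rw [contDiffOn_euclidean]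
  intro j
  induction j using Fin.cases with
  | zero => simpa only [totalDerivative_zero] using contDiffOn_const
  | succ j =>
    induction j using Fin.lastCases with
    | last => simpa only [Fin.succ_last, totalDerivative_last] using contDiffOn_const
    | cast j => simpa only [totalDerivative_castSucc_succ] using contDiffOn_pi.1 hG j

theorem finrank_odeDistribution_le (G : EuclideanSpace ℝ (Fin (N + 2)) → Fin N → ℝ)
    (p : EuclideanSpace ℝ (Fin (N + 2))) : Module.finrank ℝ (odeDistribution G p) ≤ 2 := by
  have h_card := finrank_span_le_card (R := ℝ)
    ({totalDerivative G p, lastVector N} : Set (EuclideanSpace ℝ (Fin (N + 2))))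
  classical exact h_card.trans (by simpa using Finset.card_le_two)

variable {m n : ℕ}

/-- The coefficients `(y_1, …, y_(m-1), F, z_1, …, z_n)` of the total derivative of the Monge
equation. -/
def mongeSystem (m n : ℕ) (F : EuclideanSpace ℝ (Fin (m + n + 2)) → ℝ)
    (p : EuclideanSpace ℝ (Fin (m + n + 2))) (i : Fin (m + n)) : ℝ :=
  if i.val + 1 = m then F p else p i.succ.succ

theorem contDiffOn_mongeSystem {W : Set (EuclideanSpace ℝ (Fin (m + n + 2)))}
    {F : EuclideanSpace ℝ (Fin (m + n + 2)) → ℝ} (hF : ContDiffOn ℝ ∞ F W) :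
    ContDiffOn ℝ ∞ (mongeSystem m n F) W := by
  refine contDiffOn_pi.2 fun i => ?_
  unfold mongeSystem
  split_ifs
  exacts [hF, by fun_prop]

theorem totalDerivative_mongeSystem (F : EuclideanSpace ℝ (Fin (m + n + 2)) → ℝ)
    (p : EuclideanSpace ℝ (Fin (m + n + 2))) {k : ℕ} (hk : 0 < k) (hk' : k < m + n + 1) :
    totalDerivative (mongeSystem m n F) p ⟨k, by omega⟩ =
      if k = m then F p else p ⟨k + 1, by omega⟩ := by
  obtain ⟨k, rfl⟩ := Nat.exists_eq_add_of_lt hk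
  exact (totalDerivative_castSucc_succ _ p ⟨0 + k, by omega⟩).trans rfl

/-- The projection of the jet space of a Monge equation to the coordinates
`(x, z_n, z_(n-1), z_(n-2), y_(m-1))`. -/
noncomputable def jetProjection (m n : ℕ) :
    EuclideanSpace ℝ (Fin (m + n + 2)) →L[ℝ] Fin 5 → ℝ :=
  ContinuousLinearMap.pi fun i => EuclideanSpace.proj
    (![0, Fin.last (m + n + 1), ⟨m + n, by omega⟩, ⟨m + n - 1, by omega⟩, ⟨m, by omega⟩] i)

theorem jetProjection_totalDerivative (hm : 0 < m) (hn : 2 ≤ n)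
    (F : EuclideanSpace ℝ (Fin (m + n + 2)) → ℝ) (p : EuclideanSpace ℝ (Fin (m + n + 2))) :
    jetProjection m n (totalDerivative (mongeSystem m n F) p) =
      ![1, 0, jetProjection m n p 1, jetProjection m n p 2, F p] := by
  ext i
  fin_cases i
  · exact totalDerivative_zero (mongeSystem m n F) p
  · exact totalDerivative_last (mongeSystem m n F) p
  · exact (totalDerivative_mongeSystem F p (k := m + n) (by omega) (by omega)).trans
      (if_neg (by omega))
  · refine (totalDerivative_mongeSystem F p (by omega) (by omega)).trans
      ((if_neg (by omega)).trans ?_)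
    exact congrArg (p ·) (Fin.ext (show m + n - 1 + 1 = m + n by omega))
  · exact (totalDerivative_mongeSystem F p hm (by omega)).trans (if_pos rfl)

theorem jetProjection_lastVector (hn : 2 ≤ n) :
    jetProjection m n (lastVector (m + n)) = ![0, 1, 0, 0, 0] := by
  have h_coord (k : ℕ) (hk : k < m + n + 1) : lastVector (m + n) ⟨k, by omega⟩ = 0 := by
    have h_ne : (⟨k, by omega⟩ : Fin (m + n + 2)) ≠ Fin.last (m + n + 1) := Fin.ne_of_lt hk
    simp [lastVector, h_ne]
  ext i
  fin_cases i
  exacts [h_coord 0 (by omega), by simp [jetProjection, lastVector], h_coord (m + n) (by omega),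
    h_coord (m + n - 1) (by omega), h_coord m (by omega)]

theorem growth_mongeDistribution {W : Set (EuclideanSpace ℝ (Fin (m + n + 2)))}
    {F : EuclideanSpace ℝ (Fin (m + n + 2)) → ℝ} (hm : 0 < m) (hn : 2 ≤ n) (hW : IsOpen W)
    (hF : ContDiffOn ℝ ∞ F W) {p : EuclideanSpace ℝ (Fin (m + n + 2))} (hp : p ∈ W)
    (h_nondegenerate :
      fderiv ℝ (fun q => fderiv ℝ F q (lastVector (m + n))) p (lastVector (m + n)) ≠ 0) :
    Module.finrank ℝ (weakFlag (mongeDistribution m n F) 1 p) = 2 ∧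
      3 ≤ Module.finrank ℝ (weakFlag (mongeDistribution m n F) 2 p) ∧
      5 ≤ Module.finrank ℝ (weakFlag (mongeDistribution m n F) 3 p) := by
  have hX := contDiffOn_totalDerivative (contDiffOn_mongeSystem hF)
  have h_indep := linearIndependent_bracketFrame hW hX
    (fun q _ => jetProjection_totalDerivative hm hn F q) (jetProjection_lastVector hn) hp
    h_nondegenerate
  have h_mem := bracketFrame_mem_weakFlag (Δ := mongeDistribution m n F) hW hX
    (fun _ _ => Submodule.subset_span (Set.mem_insert _ _))
    (fun _ _ => Submodule.subset_span (Set.mem_insert_of_mem _ rfl)) hp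
  exact ⟨(finrank_odeDistribution_le _ p).antisymm
      (le_finrank_weakFlag h_mem h_indep (r := 2) (k := 1) (by decide) (by decide)),
    le_finrank_weakFlag h_mem h_indep (r := 3) (by decide) (by decide),
    le_finrank_weakFlag h_mem h_indep le_rfl (by decide)⟩

end Monge

end Monge

theorem theorem3_general :
    (∀ (E : Type*) [NormedAddCommGroup E] [NormedSpace ℝ E] (M : Type*) [TopologicalSpace M]
        [ChartedSpace E M] [IsManifold 𝓘(ℝ, E) ∞ M]
        (Δ : ∀ x : M, Submodule ℝ (TangentSpace 𝓘(ℝ, E) x)) (W : Set M),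
        Monge.HasGrowthTwoOneTwoOn Δ W → Monge.IsFlatOn Δ W →
        Monge.ArisesFromHilbertCartanOn Δ W) ∧
    (∀ (m n : ℕ) (W : Set (EuclideanSpace ℝ (Fin (m + n + 2))))
        (F : EuclideanSpace ℝ (Fin (m + n + 2)) → ℝ),
        0 < m → 2 ≤ n → IsOpen W → ContDiffOn ℝ ∞ F W →
        (∀ p ∈ W, fderiv ℝ (fun q => fderiv ℝ F q (Monge.lastVector (m + n))) p
          (Monge.lastVector (m + n)) ≠ 0) →
        Monge.IsFlatOn (Monge.mongeDistribution m n F) W →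
        Monge.ArisesFromHilbertCartanOn (Monge.mongeDistribution m n F) W) := by
  refine ⟨fun E _ _ M _ _ _ Δ W h_growth h_flat => ?_,
    fun m n W F hm hn hW hF h_nondegenerate h_flat => ?_⟩
  · refine Monge.arisesFromHilbertCartanOn_of_isFlatOn h_flat fun p hp => ?_
    obtain ⟨h_one, h_two, h_three⟩ := h_growth p hp
    exact ⟨h_one, h_two.ge, h_three.ge⟩
  · exact Monge.arisesFromHilbertCartanOn_of_isFlatOn h_flat fun p hp =>
      Monge.growth_mongeDistribution hm hn hW hF hp (h_nondegenerate p hp)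

theorem theorem3 :
    -- an arbitrary flat rank 2 distribution with growth vector (2, 1, 2, ...) on a manifold
    (∀ (d : ℕ) (M : Type*) [TopologicalSpace M] [ChartedSpace (EuclideanSpace ℝ (Fin d)) M]
        [IsManifold 𝓘(ℝ, EuclideanSpace ℝ (Fin d)) ∞ M]
        (Δ : ∀ x : M, Submodule ℝ (TangentSpace 𝓘(ℝ, EuclideanSpace ℝ (Fin d)) x)),
        Monge.IsDistribution Δ 2 → Monge.HasGrowthTwoOneTwoOn Δ Set.univ →
        Monge.IsFlatOn Δ Set.univ →
        Monge.ArisesFromHilbertCartanOn Δ Set.univ) ∧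
    -- a flat non-degenerate Monge equation
    (∀ (m n : ℕ) (W : Set (EuclideanSpace ℝ (Fin (m + n + 2))))
        (F : EuclideanSpace ℝ (Fin (m + n + 2)) → ℝ),
        0 < m → m ≤ n → (m, n) ≠ (1, 1) → IsOpen W → ContDiffOn ℝ ∞ F W →
        (∀ p ∈ W, fderiv ℝ (fun q => fderiv ℝ F q (Monge.lastVector (m + n))) p
          (Monge.lastVector (m + n)) ≠ 0) →
        Monge.IsFlatOn (Monge.mongeDistribution m n F) W →
        Monge.ArisesFromHilbertCartanOn (Monge.mongeDistribution m n F) W) ∧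
    -- a flat underdetermined system of ODEs with growth vector (2, 1, 2, ...)
    (∀ (N : ℕ) (W : Set (EuclideanSpace ℝ (Fin (N + 2))))
        (G : EuclideanSpace ℝ (Fin (N + 2)) → Fin N → ℝ),
        IsOpen W → ContDiffOn ℝ ∞ G W →
        Monge.HasGrowthTwoOneTwoOn (Monge.odeDistribution G) W →
        Monge.IsFlatOn (Monge.odeDistribution G) W →
        Monge.ArisesFromHilbertCartanOn (Monge.odeDistribution G) W) := by
  refine ⟨fun _ M _ _ _ Δ _ => theorem3_general.1 _ M Δ Set.univ,
    fun m n W F hm hmn hne => theorem3_general.{0, 0}.2 m n W F hm ?_,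
    fun N W G _ _ => theorem3_general.1 _ _ (Monge.odeDistribution G) W⟩
  by_contra hn
  exact hne (Prod.ext_iff.2 (by lia))
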